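/- Let $SYT_n$ be the set of standard Young tableaux with $n$ cells. For a permutation $w\in S_n$ let $I(w)$ be its Robinson--Schensted (row) insertion tableau, and for $T\in SYT_n$ let $\mathcal Y_T=\{w\in S_n : I(w)=T\}$ be its Knuth class. The right weak Bruhat order on $S_n$ is the reflexive and transitive closure of the relations $u\le u s_i$ with $\operatorname{len}(us_i)=\operatorname{len}(u)+1$, where $s_i=(i,i+1)$ and $\operatorname{len}$ is the length of a reduced word. The weak order $\le_{weak}$ on $SYT_n$ is the reflexive and transitive closure of the relation: $S\le T$ if there are $\sigma\in\mathcal Y_S$, $\tau\in\mathcal Y_T$ with $\sigma\le\tau$ in the right weak Bruhat order. For $k<n$ and $R\in SYT_k$ let $SYT_n^R$ be the set of those $T\in SYT_n$ whose restriction $T_{[1,k]}$ to the entries $1,\dots,k$ is $R$, with the order induced from $\le_{weak}$. For $R,R'\in SYT_k$ of the same shape let $\mathcal V_{[R,R']}:SYT_n^R\to SYT_n^{R'}$ be the map that replaces the inner tableau $R$ of $T$ by $R'$. Write $\lessdot$ for a covering relation. **Corollary.** Let $1\le k<n$, let $R\in SYT_k$ have exactly two columns, and let $R'\in SYT_k$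 have the same shape as $R$. If $S\lessdot T$ is a covering relation in $SYT_n^R$, then $\mathcal V_{[R,R']}(S)\lessdot\mathcal V_{[R,R']}(T)$ is a covering relation in $SYT_n^{R'}$. -/

import Mathlib

namespace TableauWeakOrder

/-- A standard Young tableau with `n` cells: a filling of a Young diagram by `1, …, n`, each used
exactly once, increasing along rows (left to right) and down columns.  The filling is an
unrestricted function, required to vanish outside the diagram. -/
@[ext]
structure SYT (n : ℕ) where
  shape : YoungDiagram
  entry : ℕ → ℕ → ℕ
  row_lt : ∀ {i j₁ j₂ : ℕ}, j₁ < j₂ → (i, j₂) ∈ shape → entry i j₁ < entry i j₂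
  col_lt : ∀ {i₁ i₂ j : ℕ}, i₁ < i₂ → (i₂, j) ∈ shape → entry i₁ j < entry i₂ j
  zeros : ∀ {i j : ℕ}, (i, j) ∉ shape → entry i j = 0
  bijOn : Set.BijOn (fun c : ℕ × ℕ => entry c.1 c.2) {c | c ∈ shape} (Set.Icc 1 n)

/-! ### Robinson-Schensted row insertion -/

/-- Insert `x` in an increasing row.  If `x` is larger than all entries it is appended; otherwise
it replaces the smallest (i.e. the leftmost) entry larger than `x`, and that entry is returned. -/
def rowInsert : List ℕ → ℕ → List ℕ × Option ℕ
  | [], x => ([x], none)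
  | a :: r, x =>
    if x < a then (x :: r, some a) else (a :: (rowInsert r x).1, (rowInsert r x).2)

/-- Insert `x` in a tableau given by its list of rows: the entry bumped from a row is inserted
in the next row. -/
def tableauInsert : List (List ℕ) → ℕ → List (List ℕ)
  | [], x => [[x]]
  | r :: rs, x =>
    match rowInsert r x with
    | (r', none) => r' :: rs
    | (r', some y) => r' :: tableauInsert rs y

/-- The rows of the insertion tableau of a word. -/
def insertionRows (w : List ℕ) : List (List ℕ) :=
  w.foldl tableauInsert []

/-- One-line notation `w₁ w₂ … wₙ`, with letters `1, …, n`, of a permutation. -/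
def oneLine {n : ℕ} (w : Equiv.Perm (Fin n)) : List ℕ :=
  List.ofFn fun i => (w i : ℕ) + 1

/-- The Knuth class of `T`: all permutations whose insertion tableau is `T`.  (All entries of a
tableau are positive, so reading `0` off the tableau loses no information.) -/
def knuthClass {n : ℕ} (T : SYT n) : Set (Equiv.Perm (Fin n)) :=
  {w | ∀ i j : ℕ, ((insertionRows (oneLine w)).getD i []).getD j 0 = T.entry i j}

/-! ### The right weak Bruhat order on permutations -/

/-- `s` is one of the adjacent transpositions `(i, i+1)`. -/
def IsSimple {n : ℕ} (s : Equiv.Perm (Fin n)) : Prop :=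
  ∃ i j : Fin n, (j : ℕ) = (i : ℕ) + 1 ∧ s = Equiv.swap i j

/-- The length of a permutation: the number of letters of a reduced word, i.e. of a shortest
expression as a product of adjacent transpositions. -/
noncomputable def len {n : ℕ} (w : Equiv.Perm (Fin n)) : ℕ :=
  sInf {m | ∃ l : List (Equiv.Perm (Fin n)), (∀ s ∈ l, IsSimple s) ∧ l.prod = w ∧ l.length = m}

/-- The generating relations of the right weak order: `w = u · sᵢ` with `len w = len u + 1`. -/
def PermStep {n : ℕ} (u w : Equiv.Perm (Fin n)) : Prop :=
  ∃ s, IsSimple s ∧ w = u * s ∧ len w = len u + 1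

/-- The right weak Bruhat order on permutations. -/
def PermWeakLE {n : ℕ} : Equiv.Perm (Fin n) → Equiv.Perm (Fin n) → Prop :=
  Relation.ReflTransGen PermStep

/-! ### The weak order on standard Young tableaux -/

/-- `S` and `T` have representatives `σ ≤ τ` in their Knuth classes. -/
def TableauStep {n : ℕ} (S T : SYT n) : Prop :=
  ∃ σ ∈ knuthClass S, ∃ τ ∈ knuthClass T, PermWeakLE σ τ

/-- The weak order: the (reflexive and) transitive closure of `TableauStep`. -/
instance {n : ℕ} : LE (SYT n) :=
  ⟨Relation.ReflTransGen TableauStep⟩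

instance {n : ℕ} : LT (SYT n) :=
  ⟨fun S T => S ≤ T ∧ S ≠ T⟩

/-! ### Inner tableaux -/

/-- The cells of `T` with entry at most `k`. -/
def SYT.restrictShape {n : ℕ} (k : ℕ) (T : SYT n) : YoungDiagram where
  cells := T.shape.cells.filter fun c => T.entry c.1 c.2 ≤ k
  isLowerSet := by
    rintro ⟨i₂, j₂⟩ ⟨i₁, j₁⟩ hle hc
    obtain ⟨hi, hj⟩ : i₁ ≤ i₂ ∧ j₁ ≤ j₂ := hle
    rw [Finset.mem_coe, Finset.mem_filter, YoungDiagram.mem_cells] at hc ⊢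
    have h1 : (i₂, j₁) ∈ T.shape := T.shape.up_left_mem le_rfl hj hc.1
    refine ⟨T.shape.up_left_mem hi hj hc.1, ?_⟩
    have a : T.entry i₂ j₁ ≤ T.entry i₂ j₂ := by
      rcases hj.eq_or_lt with h | h
      · rw [h]
      · exact (T.row_lt h hc.1).le
    have b : T.entry i₁ j₁ ≤ T.entry i₂ j₁ := by
      rcases hi.eq_or_lt with h | h
      · rw [h]
      · exact (T.col_lt h h1).le
    exact (b.trans a).trans hc.2

theorem SYT.mem_restrictShape {n k : ℕ} {T : SYT n} {c : ℕ × ℕ} :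
    c ∈ T.restrictShape k ↔ c ∈ T.shape ∧ T.entry c.1 c.2 ≤ k := by
  rw [← YoungDiagram.mem_cells, SYT.restrictShape, Finset.mem_filter, YoungDiagram.mem_cells]

/-- The restriction `T_{[1,k]}` of a tableau to its entries `1, …, k`.  (These already fill a
Young diagram, so no sliding is needed.) -/
def SYT.restrict {n k : ℕ} (hkn : k ≤ n) (T : SYT n) : SYT k where
  shape := T.restrictShape k
  entry i j := if T.entry i j ≤ k then T.entry i j else 0
  row_lt := by
    intro i j₁ j₂ h hc
    rw [SYT.mem_restrictShape] at hc
    have := T.row_lt h hc.1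
    rw [if_pos hc.2, if_pos (this.le.trans hc.2)]
    exact this
  col_lt := by
    intro i₁ i₂ j h hc
    rw [SYT.mem_restrictShape] at hc
    have := T.col_lt h hc.1
    rw [if_pos hc.2, if_pos (this.le.trans hc.2)]
    exact this
  zeros := by
    intro i j hc
    rw [SYT.mem_restrictShape, not_and] at hc
    by_cases h : (i, j) ∈ T.shape
    · exact if_neg (hc h)
    · simp [T.zeros h]
  bijOn := by
    refine ⟨?_, ?_, ?_⟩
    · intro c hc
      have hc := SYT.mem_restrictShape.1 hc
      have := T.bijOn.mapsTo hc.1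
      simp only [hc.2, if_true]
      exact ⟨this.1, hc.2⟩
    · intro c hc d hd h
      have hc := SYT.mem_restrictShape.1 hc
      have hd := SYT.mem_restrictShape.1 hd
      simp only [hc.2, hd.2, if_true] at h
      exact T.bijOn.injOn hc.1 hd.1 h
    · intro m hm
      obtain ⟨c, hc, h⟩ := T.bijOn.surjOn (⟨hm.1, hm.2.trans hkn⟩ : m ∈ Set.Icc 1 n)
      have h' : T.entry c.1 c.2 = m := h
      refine ⟨c, SYT.mem_restrictShape.2 ⟨hc, h' ▸ hm.2⟩, ?_⟩
      simp only [h', hm.2, if_true]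

/-- The set `SYT_n^R` of tableaux with `n` cells and inner tableau `R`, as a subtype; it carries
the order induced from `SYT n`. -/
abbrev SYTInner {n k : ℕ} (hkn : k ≤ n) (R : SYT k) : Type :=
  {T : SYT n // T.restrict hkn = R}

theorem mem_inner_iff {n k : ℕ} {hkn : k ≤ n} {R : SYT k} (T : SYTInner hkn R) (i j : ℕ) :
    (i, j) ∈ R.shape ↔ (i, j) ∈ T.1.shape ∧ T.1.entry i j ≤ k := by
  obtain ⟨T, rfl⟩ := T
  exact SYT.mem_restrictShape

theorem SYT.one_le {n : ℕ} (T : SYT n) {i j : ℕ} (h : (i, j) ∈ T.shape) : 1 ≤ T.entry i j :=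
  (T.bijOn.mapsTo (x := (i, j)) h).1

theorem SYT.le_size {n : ℕ} (T : SYT n) {i j : ℕ} (h : (i, j) ∈ T.shape) : T.entry i j ≤ n :=
  (T.bijOn.mapsTo (x := (i, j)) h).2

/-- The tableau obtained from `T`, with inner tableau `R`, by replacing `R` with the tableau `R'`
of the same shape. -/
def replaceInner {n k : ℕ} {hkn : k ≤ n} {R R' : SYT k} (hsh : R'.shape = R.shape)
    (T : SYTInner hkn R) : SYT n where
  shape := T.1.shape
  entry i j := if (i, j) ∈ R.shape then R'.entry i j else T.1.entry i j
  row_lt := by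
    intro i j₁ j₂ h hc
    by_cases h2 : (i, j₂) ∈ R.shape
    · rw [if_pos (R.shape.up_left_mem le_rfl h.le h2), if_pos h2]
      exact R'.row_lt h (hsh ▸ h2)
    · rw [if_neg h2]
      by_cases h1 : (i, j₁) ∈ R.shape
      · rw [if_pos h1]
        have := R'.le_size (hsh ▸ h1)
        have := mt (fun h => (mem_inner_iff T i j₂).2 ⟨hc, h⟩) h2
        omega
      · rw [if_neg h1]
        exact T.1.row_lt h hc
  col_lt := by
    intro i₁ i₂ j h hc
    by_cases h2 : (i₂, j) ∈ R.shape
    · rw [if_pos (R.shape.up_left_mem h.le le_rfl h2), if_pos h2]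
      exact R'.col_lt h (hsh ▸ h2)
    · rw [if_neg h2]
      by_cases h1 : (i₁, j) ∈ R.shape
      · rw [if_pos h1]
        have := R'.le_size (hsh ▸ h1)
        have := mt (fun h => (mem_inner_iff T i₂ j).2 ⟨hc, h⟩) h2
        omega
      · rw [if_neg h1]
        exact T.1.col_lt h hc
  zeros := by
    intro i j hc
    rw [if_neg fun h => hc ((mem_inner_iff T i j).1 h).1]
    exact T.1.zeros hc
  bijOn := by
    have hbig : ∀ c : ℕ × ℕ, c ∈ T.1.shape → c ∉ R.shape → k < T.1.entry c.1 c.2 := by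
      intro c hc h
      by_contra h'
      exact h ((mem_inner_iff T c.1 c.2).2 ⟨hc, not_lt.1 h'⟩)
    refine ⟨?_, ?_, ?_⟩
    · intro c hc
      by_cases h : c ∈ R.shape
      · have h' : (c.1, c.2) ∈ R'.shape := hsh ▸ h
        simp only [h, if_true]
        exact ⟨R'.one_le h', (R'.le_size h').trans hkn⟩
      · simp only [h, if_false]
        exact T.1.bijOn.mapsTo hc
    · intro c hc d hd he
      by_cases h1 : c ∈ R.shape <;> by_cases h2 : d ∈ R.shape <;>
        simp only [h1, h2, if_true, if_false] at he
      · exact R'.bijOn.injOn (hsh ▸ h1 : c ∈ R'.shape) (hsh ▸ h2 : d ∈ R'.shape) he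
      · have := R'.le_size (i := c.1) (j := c.2) (hsh ▸ h1)
        have := hbig d hd h2
        omega
      · have := R'.le_size (i := d.1) (j := d.2) (hsh ▸ h2)
        have := hbig c hc h1
        omega
      · exact T.1.bijOn.injOn hc hd he
    · intro m hm
      by_cases hmk : m ≤ k
      · obtain ⟨c, hc, h⟩ := R'.bijOn.surjOn (⟨hm.1, hmk⟩ : m ∈ Set.Icc 1 k)
        have hc' : c ∈ R.shape := hsh ▸ hc
        refine ⟨c, ((mem_inner_iff T c.1 c.2).1 hc').1, ?_⟩
        simp only [hc', if_true]
        exact h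
      · obtain ⟨c, hc, h⟩ := T.1.bijOn.surjOn hm
        have h' : T.1.entry c.1 c.2 = m := h
        have hc' : c ∉ R.shape := fun hc' =>
          hmk (h' ▸ ((mem_inner_iff T c.1 c.2).1 hc').2)
        refine ⟨c, hc, ?_⟩
        simp only [hc', if_false]
        exact h

theorem replaceInner_restrict {n k : ℕ} {hkn : k ≤ n} {R R' : SYT k} (hsh : R'.shape = R.shape)
    (T : SYTInner hkn R) : (replaceInner hsh T).restrict hkn = R' := by
  have key : ∀ i j : ℕ, (i, j) ∈ T.1.shape → (i, j) ∉ R.shape → ¬ T.1.entry i j ≤ k :=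
    fun i j hc h h' => h ((mem_inner_iff T i j).2 ⟨hc, h'⟩)
  ext i j
  · obtain ⟨a, b⟩ := i
    simp only [SYT.restrict, SYT.restrictShape, replaceInner, Finset.mem_filter, YoungDiagram.mem_cells]
    by_cases h : (a, b) ∈ R.shape
    · have h' : (a, b) ∈ R'.shape := hsh ▸ h
      simp [h, h', R'.le_size h', ((mem_inner_iff T a b).1 h).1]
    · have h' : (a, b) ∉ R'.shape := hsh ▸ h
      simp only [h, h', if_false, iff_false, not_and]
      exact fun hc => key a b hc h
  · simp only [SYT.restrict, replaceInner]
    by_cases h : (i, j) ∈ R.shape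
    · have h' : (i, j) ∈ R'.shape := hsh ▸ h
      simp [h, R'.le_size h']
    · have h' : (i, j) ∉ R'.shape := hsh ▸ h
      simp only [h, if_false, R'.zeros h']
      by_cases hc : (i, j) ∈ T.1.shape
      · exact if_neg (key i j hc h)
      · simp [T.1.zeros hc]

/-- The inner tableau translation map `𝒱_{[R,R']} : SYT_n^R → SYT_n^{R'}`. -/
def innerTranslation {n k : ℕ} (hkn : k ≤ n) {R R' : SYT k} (hsh : R'.shape = R.shape)
    (T : SYTInner hkn R) : SYTInner hkn R' :=
  ⟨replaceInner hsh T, replaceInner_restrict hsh T⟩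

end TableauWeakOrder

namespace TableauWeakOrder

/-! The translation `innerTranslation` is bijective, with inverse the translation from `R'` to `R`,
and `R'` has as many columns as `R`. So it is enough to show that translation is monotone when the
inner tableau has at most two columns (`replaceInner_mono`): translations in both directions then
preserve strict inequalities, and a tableau strictly between two images would pull back to one
strictly between `S` and `T`.

For monotonicity, refine `S ≤ T` to a chain of tableaux in which neighbours have representatives
differing by one swap of adjacent letters `a b` to `b a`, `a < b`. The whole chain has inner tableau
`R` (`restrict_eq_of_between`). Indeed, the entries of the first column can be read off the
decreasing subsequences with bounded letters, and `a b ↦ b a` only creates such subsequences, so the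
first columns move monotonically and agree at both ends as far as letters `≤ k` are concerned.
Dually, no letter `≤ k` can appear in a third column. A tableau with two columns is determined by
its first one.

It remains to translate a single swap. If its larger letter `b` exceeds `k`, the swap does not
change the subword of letters `≤ k`. Replace this subword by the word that has insertion tableau
`R'` and the same recording tableau. Letters above `k` then move through the insertion as before, so
only the inner tableau changes, and the new words still differ by a swap of an ascent
(`replaceInner_le_of_large`).

If `b ≤ k`, the equality of the two inner tableaux and the absence of a third column provide a
letter `c` with `a < c < b` close to the pair (`exists_swap_large`). Knuth moves then either
identify the two words or trade the swap of `a, b` for the swap of `c` with some `x > b`. The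
smaller letter grows, so after finitely many trades the two words are Knuth equivalent or the larger
letter exceeds `k`. -/

/-- Knuth equivalence of words. -/
inductive Knuth : List ℕ → List ℕ → Prop
  | refl (w) : Knuth w w
  | symm {v w} : Knuth v w → Knuth w v
  | trans {u v w} : Knuth u v → Knuth v w → Knuth u w
  | yxz (A B : List ℕ) {x y z : ℕ} : x < y → y < z →
      Knuth (A ++ y :: x :: z :: B) (A ++ y :: z :: x :: B)
  | xzy (A B : List ℕ) {x y z : ℕ} : x < y → y < z →
      Knuth (A ++ x :: z :: y :: B) (A ++ z :: x :: y :: B)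

namespace Knuth

theorem append_left (C : List ℕ) {v w : List ℕ} (h : Knuth v w) : Knuth (C ++ v) (C ++ w) := by
  induction h with
  | refl w => exact refl _
  | symm _ ih => exact ih.symm
  | trans _ _ ih₁ ih₂ => exact ih₁.trans ih₂
  | yxz A B h₁ h₂ => simpa using yxz (C ++ A) B h₁ h₂
  | xzy A B h₁ h₂ => simpa using xzy (C ++ A) B h₁ h₂

theorem append_right (C : List ℕ) {v w : List ℕ} (h : Knuth v w) : Knuth (v ++ C) (w ++ C) := by
  induction h with
  | refl w => exact refl _
  | symm _ ih => exact ih.symm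
  | trans _ _ ih₁ ih₂ => exact ih₁.trans ih₂
  | yxz A B h₁ h₂ => simpa using yxz A (B ++ C) h₁ h₂
  | xzy A B h₁ h₂ => simpa using xzy A (B ++ C) h₁ h₂

theorem cons (a : ℕ) {v w : List ℕ} (h : Knuth v w) : Knuth (a :: v) (a :: w) :=
  h.append_left [a]

theorem context (A B : List ℕ) {v w : List ℕ} (h : Knuth v w) :
    Knuth (A ++ v ++ B) (A ++ w ++ B) :=
  (h.append_left A).append_right B

/-- Reversal exchanges the two elementary relations. It lets results on decreasing subsequences
serve for increasing ones, and rearrangements to the left serve for those to the right. -/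
theorem reverse {v w : List ℕ} (h : Knuth v w) : Knuth v.reverse w.reverse := by
  induction h with
  | refl w => exact refl _
  | symm _ ih => exact ih.symm
  | trans _ _ ih₁ ih₂ => exact ih₁.trans ih₂
  | yxz A B h₁ h₂ => simpa using (xzy B.reverse A.reverse h₁ h₂).symm
  | xzy A B h₁ h₂ => simpa using (yxz B.reverse A.reverse h₁ h₂).symm

theorem perm {v w : List ℕ} (h : Knuth v w) : v.Perm w := by
  induction h with
  | refl w => exact List.Perm.refl _
  | symm _ ih => exact ih.symm
  | trans _ _ ih₁ ih₂ => exact ih₁.trans ih₂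
  | yxz A B h₁ h₂ => exact List.Perm.append_left _ ((List.Perm.swap _ _ _).cons _)
  | xzy A B h₁ h₂ => exact List.Perm.append_left _ (List.Perm.swap _ _ _)

end Knuth

/-! ### Insertion and Knuth equivalence -/

/-- Insert the letters of a word in a row one after the other; the bumped letters form a word. -/
def rowInsertWord : List ℕ → List ℕ → List ℕ × List ℕ
  | r, [] => (r, [])
  | r, x :: w =>
    ((rowInsertWord (rowInsert r x).1 w).1,
      (rowInsert r x).2.toList ++ (rowInsertWord (rowInsert r x).1 w).2)

theorem rowInsert_of_le {a x : ℕ} (r : List ℕ) (h : a ≤ x) :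
    rowInsert (a :: r) x = (a :: (rowInsert r x).1, (rowInsert r x).2) := by
  rw [rowInsert, if_neg (not_lt.2 h)]

theorem rowInsert_of_lt {a x : ℕ} (r : List ℕ) (h : x < a) :
    rowInsert (a :: r) x = (x :: r, some a) := by
  rw [rowInsert, if_pos h]

theorem rowInsertWord_cons_of_le {a : ℕ} (r : List ℕ) :
    ∀ {w : List ℕ}, (∀ x ∈ w, a ≤ x) →
      rowInsertWord (a :: r) w = (a :: (rowInsertWord r w).1, (rowInsertWord r w).2)
  | [], _ => rfl
  | x :: w, h => by
    rw [List.forall_mem_cons] at h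
    simp only [rowInsertWord, rowInsert_of_le r h.1]
    rw [rowInsertWord_cons_of_le _ h.2]

/-- Row by row decoupling: the first row digests the whole word, and the lower rows only see the
word of bumped letters. Invariance under Knuth relations thus reduces to one row. -/
theorem foldl_tableauInsert_cons (rs : List (List ℕ)) :
    ∀ (w : List ℕ) (r : List ℕ), w.foldl tableauInsert (r :: rs) =
      (rowInsertWord r w).1 :: (rowInsertWord r w).2.foldl tableauInsert rs := by
  intro w
  induction w generalizing rs with
  | nil => intro r; rfl
  | cons x w ih =>
    intro r
    simp only [List.foldl_cons, tableauInsert, rowInsertWord, List.foldl_append]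
    rcases h : rowInsert r x with ⟨r', _ | y⟩ <;> simp [ih]

theorem lt_of_mem_rowInsert {r : List ℕ} {x y : ℕ} (h : (rowInsert r x).2 = some y) :
    x < y ∧ y ∈ r := by
  induction r with
  | nil => simp [rowInsert] at h
  | cons a r ih =>
    rw [rowInsert] at h
    split_ifs at h with hx
    · simp only [Option.some.injEq] at h
      subst h
      exact ⟨hx, by simp⟩
    · exact ⟨(ih h).1, by simp [(ih h).2]⟩

theorem rowInsert_perm (r : List ℕ) (x : ℕ) :
    ((rowInsert r x).2.toList ++ (rowInsert r x).1).Perm (x :: r) := by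
  induction r with
  | nil => simp [rowInsert]
  | cons a r ih =>
    rcases lt_or_ge x a with h | h
    · rw [rowInsert_of_lt r h]
      exact List.Perm.swap _ _ _
    · rw [rowInsert_of_le r h]
      exact List.perm_middle.trans ((ih.cons a).trans (List.Perm.swap _ _ _))

theorem mem_rowInsert {r : List ℕ} {x y : ℕ} (h : y ∈ (rowInsert r x).1) : y = x ∨ y ∈ r := by
  have := (rowInsert_perm r x).subset (List.mem_append_right _ h)
  simpa using this

theorem rowInsert_sorted {r : List ℕ} {x : ℕ} (h : r.Pairwise (· ≤ ·)) :
    (rowInsert r x).1.Pairwise (· ≤ ·) := by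
  induction r with
  | nil => simp [rowInsert]
  | cons a r ih =>
    rw [List.pairwise_cons] at h
    rcases lt_or_ge x a with hx | hx
    · rw [rowInsert_of_lt r hx, List.pairwise_cons]
      exact ⟨fun b hb => hx.le.trans (h.1 b hb), h.2⟩
    · rw [rowInsert_of_le r hx, List.pairwise_cons]
      refine ⟨fun b hb => ?_, ih h.2⟩
      rcases mem_rowInsert hb with rfl | hb
      · exact hx
      · exact h.1 b hb

/-- Inserting `y ≤ z` bumps letters `y' ≤ z'`. -/
theorem bump_le_bump {r : List ℕ} (hr : r.Pairwise (· ≤ ·)) {y z z' : ℕ} (h : y ≤ z)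
    (hz : (rowInsert (rowInsert r y).1 z).2 = some z') :
    ∃ y', (rowInsert r y).2 = some y' ∧ y < y' ∧ y' ≤ z' := by
  induction r with
  | nil => simp [rowInsert, not_lt.2 h] at hz
  | cons a r ih =>
    rw [List.pairwise_cons] at hr
    rcases lt_or_ge y a with hy | hy
    · rw [rowInsert_of_lt r hy] at hz ⊢
      rw [rowInsert_of_le r h] at hz
      exact ⟨a, rfl, hy, hr.1 _ (lt_of_mem_rowInsert hz).2⟩
    · rw [rowInsert_of_le r hy] at hz ⊢
      rw [rowInsert_of_le _ (hy.trans h)] at hz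
      exact ih hr.2 hz

/-- Inserting `z` and then `y < z` bumps, in the second step, a letter which is at most `z`. -/
theorem exists_bump_of_lt (r : List ℕ) {y z : ℕ} (h : y < z) :
    ∃ y', (rowInsert (rowInsert r z).1 y).2 = some y' ∧ y < y' ∧ y' ≤ z ∧ (y' ∈ r ∨ y' = z) := by
  induction r with
  | nil => exact ⟨z, by simp [rowInsert, h]⟩
  | cons a r ih =>
    rcases lt_or_ge z a with hz | hz
    · rw [rowInsert_of_lt r hz, rowInsert_of_lt r h]
      exact ⟨z, rfl, h, le_rfl, Or.inr rfl⟩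
    · rw [rowInsert_of_le r hz]
      rcases lt_or_ge y a with hy | hy
      · rw [rowInsert_of_lt _ hy]
        exact ⟨a, rfl, hy, hz, by simp⟩
      · rw [rowInsert_of_le _ hy]
        obtain ⟨y', h₁, h₂, h₃, h₄⟩ := ih
        exact ⟨y', h₁, h₂, h₃, h₄.imp_left (List.mem_cons_of_mem a)⟩

/-- The elementary Knuth relations between words with three letters, possibly repeated. -/
inductive KnuthTriple : List ℕ → List ℕ → Prop
  | yxz {x y z : ℕ} : x < y → y ≤ z → KnuthTriple [y, x, z] [y, z, x]
  | xzy {x y z : ℕ} : x ≤ y → y < z → KnuthTriple [x, z, y] [z, x, y]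

/-- If `z` bumps nothing, the bumped words agree. Otherwise `y` bumps too, and the letter bumped by
`x` is the smallest of the three, so the bumped words again form a pair of type `yxz`. Equalities
are allowed, so that the induction over the rows need not carry distinctness of letters. -/
theorem rowInsertWord_yxz {x y z : ℕ} (hxy : x < y) (hyz : y ≤ z) {r : List ℕ}
    (hr : r.Pairwise (· ≤ ·)) :
    (rowInsertWord r [y, x, z]).1 = (rowInsertWord r [y, z, x]).1 ∧
      ((rowInsertWord r [y, x, z]).2 = (rowInsertWord r [y, z, x]).2 ∨
        KnuthTriple (rowInsertWord r [y, x, z]).2 (rowInsertWord r [y, z, x]).2) := by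
  have hxz := hxy.trans_le hyz
  induction r with
  | nil => simp [rowInsertWord, rowInsert, hxy, hyz.not_gt, hxz.not_gt]
  | cons a r ih =>
    rw [List.pairwise_cons] at hr
    rcases lt_or_ge x a with hx | hx
    · rcases lt_or_ge y a with hy | hy
      · simp only [rowInsertWord, rowInsert_of_lt _ hy, rowInsert_of_lt _ hxy,
          rowInsert_of_le _ hxz.le, rowInsert_of_le _ hyz, true_and]
        rcases ho : (rowInsert r z).2 with _ | z'
        · left; simp
        · right
          exact .yxz hy (hr.1 _ (lt_of_mem_rowInsert ho).2)
      · simp only [rowInsertWord, rowInsert_of_le _ hy, rowInsert_of_lt _ hx,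
          rowInsert_of_le _ hxz.le, rowInsert_of_le _ (hy.trans hyz), true_and]
        rcases ho : (rowInsert (rowInsert r y).1 z).2 with _ | z'
        · left; simp
        · right
          obtain ⟨y', h₁, h₂, h₃⟩ := bump_le_bump hr.2 hyz ho
          rw [h₁]
          exact .yxz (hy.trans_lt h₂) h₃
    · rw [rowInsertWord_cons_of_le, rowInsertWord_cons_of_le]
      · exact ⟨congrArg (List.cons a) (ih hr.2).1, (ih hr.2).2⟩
      all_goals
        simp only [List.mem_cons, List.not_mem_nil, or_false, forall_eq_or_imp, forall_eq]
        omega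

/-- The third alternative arises when even `z` is smaller than the head of the remaining row and a
further entry follows: the bumped words then form a pair of the other type, in the opposite
direction. -/
theorem rowInsertWord_xzy {x y z : ℕ} (hxy : x ≤ y) (hyz : y < z) {r : List ℕ}
    (hr : r.Pairwise (· ≤ ·)) :
    (rowInsertWord r [x, z, y]).1 = (rowInsertWord r [z, x, y]).1 ∧
      ((rowInsertWord r [x, z, y]).2 = (rowInsertWord r [z, x, y]).2 ∨
        KnuthTriple (rowInsertWord r [x, z, y]).2 (rowInsertWord r [z, x, y]).2 ∨
          KnuthTriple (rowInsertWord r [z, x, y]).2 (rowInsertWord r [x, z, y]).2) := by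
  have hxz := hxy.trans_lt hyz
  induction r with
  | nil => simp [rowInsertWord, rowInsert, hxy.not_gt, hyz, hxz, hxz.not_gt]
  | cons a r ih =>
    rw [List.pairwise_cons] at hr
    rcases lt_or_ge x a with hx | hx
    · rcases lt_or_ge z a with hz | hz
      · simp only [rowInsertWord, rowInsert_of_lt _ hx, rowInsert_of_lt _ hz,
          rowInsert_of_lt _ hxz, rowInsert_of_le _ hxz.le, rowInsert_of_le _ hxy]
        rcases r with _ | ⟨b, r⟩
        · simp [rowInsert, hyz]
        · have hab : a ≤ b := hr.1 b (by simp)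
          rw [rowInsert_of_lt _ (hz.trans_le hab), rowInsert_of_lt _ hyz,
            rowInsert_of_lt _ (hyz.trans (hz.trans_le hab))]
          exact ⟨rfl, Or.inr (.inr (.yxz hz hab))⟩
      · simp only [rowInsertWord, rowInsert_of_lt _ hx, rowInsert_of_le _ hz,
          rowInsert_of_le _ hxz.le, rowInsert_of_le _ hxy, true_and]
        obtain ⟨y', h₁, h₂, h₃, h₄⟩ := exists_bump_of_lt r hyz
        rw [h₁]
        rcases ho : (rowInsert r z).2 with _ | z'
        · left; simp
        · right; left
          refine .xzy ?_ (h₃.trans_lt (lt_of_mem_rowInsert ho).1)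
          rcases h₄ with h₄ | rfl
          · exact hr.1 _ h₄
          · exact hz
    · rw [rowInsertWord_cons_of_le, rowInsertWord_cons_of_le]
      · exact ⟨congrArg (List.cons a) (ih hr.2).1, (ih hr.2).2⟩
      all_goals
        simp only [List.mem_cons, List.not_mem_nil, or_false, forall_eq_or_imp, forall_eq]
        omega

theorem KnuthTriple.foldl_eq {v w : List ℕ} (h : KnuthTriple v w) {T : List (List ℕ)}
    (hT : ∀ r ∈ T, r.Pairwise (· ≤ ·)) :
    v.foldl tableauInsert T = w.foldl tableauInsert T := by
  have key : ∀ {v w : List ℕ} (_ : KnuthTriple v w) {r : List ℕ} (_ : r.Pairwise (· ≤ ·)),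
      (rowInsertWord r v).1 = (rowInsertWord r w).1 ∧
        ((rowInsertWord r v).2 = (rowInsertWord r w).2 ∨
          KnuthTriple (rowInsertWord r v).2 (rowInsertWord r w).2 ∨
            KnuthTriple (rowInsertWord r w).2 (rowInsertWord r v).2) := by
    intro v w h r hr
    rcases h with ⟨h₁, h₂⟩ | ⟨h₁, h₂⟩
    · obtain ⟨h₃, h₄⟩ := rowInsertWord_yxz h₁ h₂ hr
      exact ⟨h₃, h₄.imp_right Or.inl⟩
    · exact rowInsertWord_xzy h₁ h₂ hr
  induction T generalizing v w with
  | nil =>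
    rcases h with @⟨x, y, z, h₁, h₂⟩ | @⟨x, y, z, h₁, h₂⟩
    · simp [tableauInsert, rowInsert, h₁, h₂.not_gt, (h₁.trans_le h₂).not_gt]
    · simp [tableauInsert, rowInsert, h₁.not_gt, h₂, h₁.trans_lt h₂, (h₁.trans_lt h₂).not_gt]
  | cons r rs ih =>
    rw [List.forall_mem_cons] at hT
    rw [foldl_tableauInsert_cons, foldl_tableauInsert_cons]
    obtain ⟨h₁, h₂ | h₂ | h₂⟩ := key h hT.1
    · rw [h₁, h₂]
    · rw [h₁, ih h₂ hT.2]
    · rw [h₁, ih h₂ hT.2]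

theorem tableauInsert_sorted {T : List (List ℕ)} (hT : ∀ r ∈ T, r.Pairwise (· ≤ ·)) (x : ℕ) :
    ∀ r ∈ tableauInsert T x, r.Pairwise (· ≤ ·) := by
  induction T generalizing x with
  | nil => simp [tableauInsert]
  | cons r rs ih =>
    rw [List.forall_mem_cons] at hT
    have := rowInsert_sorted (x := x) hT.1
    rw [tableauInsert]
    rcases h : rowInsert r x with ⟨r', _ | y⟩ <;> rw [h] at this <;>
      simp only [List.forall_mem_cons]
    · exact ⟨this, hT.2⟩
    · exact ⟨this, ih hT.2 y⟩

theorem insertionRows_append_singleton (w : List ℕ) (x : ℕ) :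
    insertionRows (w ++ [x]) = tableauInsert (insertionRows w) x := by
  simp [insertionRows]

theorem insertionRows_sorted (w : List ℕ) : ∀ r ∈ insertionRows w, r.Pairwise (· ≤ ·) := by
  induction w using List.reverseRecOn with
  | nil => simp [insertionRows]
  | append_singleton w x ih =>
    rw [insertionRows_append_singleton]
    exact tableauInsert_sorted ih x

/-- Knuth equivalent words have the same insertion tableau. -/
theorem Knuth.insertionRows_eq {v w : List ℕ} (h : Knuth v w) :
    insertionRows v = insertionRows w := by
  have key : ∀ (A B : List ℕ) {v w : List ℕ}, KnuthTriple v w →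
      insertionRows (A ++ (v ++ B)) = insertionRows (A ++ (w ++ B)) := by
    intro A B v w h
    have := h.foldl_eq (insertionRows_sorted A)
    rw [insertionRows] at this
    simp [insertionRows, List.foldl_append, this]
  induction h with
  | refl w => rfl
  | symm _ ih => exact ih.symm
  | trans _ _ ih₁ ih₂ => exact ih₁.trans ih₂
  | yxz A B h₁ h₂ => exact key A B (.yxz h₁ h₂.le)
  | xzy A B h₁ h₂ => exact key A B (.xzy h₁.le h₂)

/-! ### Reading words -/

/-- The row reading word of a tableau, from the bottom row to the top row. -/
def readingWord : List (List ℕ) → List ℕ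
  | [] => []
  | r :: rs => readingWord rs ++ r

theorem tableauInsert_perm (T : List (List ℕ)) (x : ℕ) :
    (readingWord (tableauInsert T x)).Perm (x :: readingWord T) := by
  induction T generalizing x with
  | nil => simp [tableauInsert, readingWord]
  | cons r rs ih =>
    have := rowInsert_perm r x
    rw [tableauInsert]
    rcases h : rowInsert r x with ⟨r', _ | y⟩ <;> rw [h] at this <;> simp only [readingWord]
    · exact (List.Perm.append_left _ this).trans List.perm_middle
    · refine ((ih y).append_right r').trans ?_
      refine List.perm_middle.symm.trans ?_
      exact (List.Perm.append_left _ this).trans List.perm_middle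

theorem readingWord_insertionRows_perm (w : List ℕ) :
    (readingWord (insertionRows w)).Perm w := by
  induction w using List.reverseRecOn with
  | nil => simp [insertionRows, readingWord]
  | append_singleton w x ih =>
    rw [insertionRows_append_singleton]
    exact (tableauInsert_perm _ _).trans ((ih.cons x).trans (List.perm_append_singleton x w).symm)

/-- The small letter `x` travels left through `s`; each step is a `yxz` move in which the letter to
the left of the exchanged pair is the middle one. -/
theorem Knuth.cons_sorted_append_singleton {a x : ℕ} {s : List ℕ}
    (hs : (a :: s).Pairwise (· < ·)) (hx : x < a) :
    Knuth (a :: (s ++ [x])) (a :: x :: s) := by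
  induction s generalizing a with
  | nil => exact refl _
  | cons b s ih =>
    rw [List.pairwise_cons] at hs
    have hab : a < b := hs.1 b (by simp)
    exact ((ih hs.2 (hx.trans hab)).cons a).trans (yxz [] s hx hab).symm

/-- Inserting `x` in a row `r` is a Knuth equivalence between `r x` and `y r'`, where `y` is the
bumped letter. -/
theorem knuth_rowInsert {r : List ℕ} (hr : r.Pairwise (· < ·)) {x : ℕ} (hx : x ∉ r) :
    Knuth (r ++ [x]) ((rowInsert r x).2.toList ++ (rowInsert r x).1) ∧
      (rowInsert r x).1.Pairwise (· < ·) ∧ ∀ f ∈ (rowInsert r x).1.head?, f ≤ x := by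
  induction r with
  | nil => exact ⟨.refl _, by simp [rowInsert]⟩
  | cons a r ih =>
    rw [List.mem_cons, not_or] at hx
    rcases lt_or_ge x a with h | h
    · rw [rowInsert_of_lt r h]
      refine ⟨.cons_sorted_append_singleton hr h, ?_, by simp⟩
      rw [List.pairwise_cons] at hr ⊢
      exact ⟨fun b hb => h.trans (hr.1 b hb), hr.2⟩
    · rw [rowInsert_of_le r h]
      rw [List.pairwise_cons] at hr
      obtain ⟨h₁, h₂, h₃⟩ := ih hr.2 hx.2
      have hax : a < x := lt_of_le_of_ne h (Ne.symm hx.1)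
      have hlt : ∀ b ∈ (rowInsert r x).1, a < b := by
        intro b hb
        rcases mem_rowInsert hb with rfl | hb
        · exact hax
        · exact hr.1 b hb
      refine ⟨(h₁.cons a).trans ?_, List.pairwise_cons.2 ⟨hlt, h₂⟩, by simpa using h⟩
      rcases ho : (rowInsert r x).2 with _ | e
      · exact .refl _
      · have hxe := (lt_of_mem_rowInsert ho).1
        have hp := (rowInsert_perm r x).length_eq
        rcases hr' : (rowInsert r x).1 with _ | ⟨f, s⟩
        · simp only [ho, hr', Option.toList, List.length_append, List.length_cons,
            List.length_nil] at hp
          have := List.length_pos_of_mem (lt_of_mem_rowInsert ho).2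
          omega
        · rw [hr'] at h₃ hlt
          -- The bumped letter `e` passes `a`, with the head `f` of the new row as witness: `a < f ≤
          -- x < e`. The bound on the head is part of the induction for this purpose.
          exact Knuth.xzy [] s (hlt f (by simp)) ((h₃ f (by simp)).trans_lt hxe)

theorem knuth_tableauInsert {T : List (List ℕ)} (hT : ∀ r ∈ T, r.Pairwise (· < ·)) {x : ℕ}
    (hx : (x :: readingWord T).Nodup) :
    Knuth (readingWord T ++ [x]) (readingWord (tableauInsert T x)) ∧
      ∀ r ∈ tableauInsert T x, r.Pairwise (· < ·) := by
  induction T generalizing x with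
  | nil => exact ⟨.refl _, by simp [tableauInsert]⟩
  | cons r rs ih =>
    rw [List.forall_mem_cons] at hT
    have hn := List.nodup_cons.1 hx
    have hxr : x ∉ r := fun h => hn.1 (by simp [readingWord, h])
    obtain ⟨h₁, h₂, -⟩ := knuth_rowInsert hT.1 hxr
    rw [tableauInsert]
    rcases h : rowInsert r x with ⟨r', _ | y⟩ <;> rw [h] at h₁ h₂ <;>
      simp only [List.forall_mem_cons, readingWord]
    · exact ⟨by simpa using h₁.append_left (readingWord rs), h₂, hT.2⟩
    · have hy : (y :: readingWord rs).Nodup := by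
        have hyr := (lt_of_mem_rowInsert (r := r) (x := x) (by rw [h])).2
        have hd := List.nodup_append.1 hn.2
        exact List.nodup_cons.2 ⟨fun hm => hd.2.2 _ hm _ hyr rfl, hd.1⟩
      obtain ⟨h₃, h₄⟩ := ih hT.2 hy
      refine ⟨?_, h₂, h₄⟩
      have h₅ := h₁.append_left (readingWord rs)
      have h₆ := h₃.append_right r'
      simp only [Option.toList, List.append_assoc, List.cons_append, List.nil_append] at h₅ h₆ ⊢
      exact h₅.trans h₆

/-- A word without repetitions is Knuth equivalent to the reading word of its insertion
tableau, whose rows are strictly increasing. -/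
theorem knuth_readingWord {w : List ℕ} (hw : w.Nodup) :
    Knuth w (readingWord (insertionRows w)) ∧
      ∀ r ∈ insertionRows w, r.Pairwise (· < ·) := by
  induction w using List.reverseRecOn with
  | nil => exact ⟨.refl _, by simp [insertionRows]⟩
  | append_singleton w x ih =>
    have hn := (List.perm_append_singleton x w).nodup_iff.1 hw
    obtain ⟨h₁, h₂⟩ := ih (List.nodup_cons.1 hn).2
    rw [insertionRows_append_singleton]
    have := knuth_tableauInsert h₂ (x := x)
      (((readingWord_insertionRows_perm w).cons x).nodup_iff.2 hn)
    exact ⟨(h₁.append_right [x]).trans this.1, this.2⟩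

/-! ### Tableaux as lists of rows -/

/-- The row `s` fits below the row `r` in a tableau. -/
def Dominates : List ℕ → List ℕ → Prop
  | _, [] => True
  | [], _ :: _ => False
  | a :: r, b :: s => a < b ∧ Dominates r s

/-- A list of rows is a tableau: the rows are non-empty and weakly increasing, the columns are
strictly increasing. -/
def IsTableau : List (List ℕ) → Prop
  | [] => True
  | r :: rs => r ≠ [] ∧ r.Pairwise (· ≤ ·) ∧ Dominates r (rs.headD []) ∧ IsTableau rs

theorem Dominates.nil (r : List ℕ) : Dominates r [] := by
  cases r <;> trivial

theorem Dominates.rowInsert_left {r s : List ℕ} (h : Dominates r s) (x : ℕ) :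
    Dominates (rowInsert r x).1 s := by
  induction r generalizing s with
  | nil =>
    rcases s with _ | ⟨b, s⟩
    · exact .nil _
    · exact h.elim
  | cons a r ih =>
    rcases s with _ | ⟨b, s⟩
    · exact .nil _
    · obtain ⟨h₁, h₂⟩ := h
      rcases lt_or_ge x a with hx | hx
      · rw [rowInsert_of_lt r hx]
        exact ⟨hx.trans h₁, h₂⟩
      · rw [rowInsert_of_le r hx]
        exact ⟨h₁, ih h₂⟩

/-- The entry below `y` is larger than `y`, so `y` settles in the next row weakly to the left of the
column it leaves. There the letter above it is now at most `x < y`. -/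
theorem Dominates.rowInsert_bump {r s : List ℕ} (h : Dominates r s) {x y : ℕ}
    (hy : (rowInsert r x).2 = some y) : Dominates (rowInsert r x).1 (rowInsert s y).1 := by
  induction r generalizing s with
  | nil => simp [rowInsert] at hy
  | cons a r ih =>
    rcases lt_or_ge x a with hx | hx
    · rw [rowInsert_of_lt r hx, Option.some.injEq] at hy
      subst hy
      rw [rowInsert_of_lt r hx]
      rcases s with _ | ⟨b, s⟩
      · exact ⟨hx, .nil _⟩
      · rw [rowInsert_of_lt s h.1]
        exact ⟨hx, h.2⟩
    · have hxy := (lt_of_mem_rowInsert hy).1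
      rw [rowInsert_of_le r hx] at hy ⊢
      rcases s with _ | ⟨b, s⟩
      · exact ⟨hx.trans_lt hxy, .nil _⟩
      · rcases lt_or_ge y b with hb | hb
        · rw [rowInsert_of_lt s hb]
          exact ⟨hx.trans_lt hxy, h.2.rowInsert_left x⟩
        · rw [rowInsert_of_le s hb]
          exact ⟨h.1, ih h.2 hy⟩

theorem headD_tableauInsert (T : List (List ℕ)) (x : ℕ) :
    (tableauInsert T x).headD [] = (rowInsert (T.headD []) x).1 := by
  rcases T with _ | ⟨r, rs⟩
  · rfl
  · rw [tableauInsert]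
    rcases h : rowInsert r x with ⟨r', _ | y⟩ <;> simp [h]

theorem rowInsert_ne_nil (r : List ℕ) (x : ℕ) : (rowInsert r x).1 ≠ [] := by
  rcases r with _ | ⟨a, r⟩
  · simp [rowInsert]
  · rw [rowInsert]
    split_ifs <;> simp

theorem IsTableau.tableauInsert {T : List (List ℕ)} (hT : IsTableau T) (x : ℕ) :
    IsTableau (tableauInsert T x) := by
  induction T generalizing x with
  | nil => simp [TableauWeakOrder.tableauInsert, IsTableau, Dominates]
  | cons r rs ih =>
    obtain ⟨-, h₂, h₃, h₄⟩ := hT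
    have h₅ := rowInsert_ne_nil r x
    have h₆ := rowInsert_sorted (x := x) h₂
    have h₇ := h₃.rowInsert_left x
    have h₈ := fun y => h₃.rowInsert_bump (x := x) (y := y)
    rw [TableauWeakOrder.tableauInsert]
    rcases h : rowInsert r x with ⟨r', _ | y⟩ <;> rw [h] at h₅ h₆ h₇ h₈
    · exact ⟨h₅, h₆, h₇, h₄⟩
    · refine ⟨h₅, h₆, ?_, ih h₄ y⟩
      rw [headD_tableauInsert]
      exact h₈ y rfl

theorem isTableau_insertionRows (w : List ℕ) : IsTableau (insertionRows w) := by
  induction w using List.reverseRecOn with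
  | nil => trivial
  | append_singleton w x ih =>
    rw [insertionRows_append_singleton]
    exact ih.tableauInsert x

theorem IsTableau.lt_of_mem {a : ℕ} {r : List ℕ} {rs : List (List ℕ)}
    (h : IsTableau ((a :: r) :: rs)) : ∀ x ∈ readingWord rs, a < x := by
  induction rs generalizing a r with
  | nil => simp [readingWord]
  | cons s rs ih =>
    obtain ⟨-, -, h₃, h₄⟩ := h
    rcases s with _ | ⟨b, s⟩
    · exact absurd rfl h₄.1
    · have hab : a < b := h₃.1
      intro x hx
      rw [readingWord, List.mem_append, List.mem_cons] at hx
      rcases hx with hx | rfl | hx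
      · exact hab.trans (ih h₄ x hx)
      · exact hab
      · exact hab.trans_le ((List.pairwise_cons.1 h₄.2.1).1 x hx)

theorem IsTableau.le_of_mem {a : ℕ} {r : List ℕ} {rs : List (List ℕ)}
    (h : IsTableau ((a :: r) :: rs)) : ∀ x ∈ readingWord ((a :: r) :: rs), a ≤ x := by
  intro x hx
  rw [readingWord, List.mem_append, List.mem_cons] at hx
  rcases hx with hx | rfl | hx
  · exact (h.lt_of_mem x hx).le
  · exact le_rfl
  · exact (List.pairwise_cons.1 h.2.1).1 x hx

/-! ### Decreasing and increasing subsequences -/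

/-- The word `w` has a decreasing subsequence with `d` letters, all of them at most `j`. -/
def DecLe (w : List ℕ) (j d : ℕ) : Prop :=
  ∃ s : List ℕ, s.Sublist w ∧ s.Pairwise (· > ·) ∧ (∀ x ∈ s, x ≤ j) ∧ s.length = d

/-- The word `w` has an increasing subsequence with `d` letters, all of them at most `j`. -/
def IncLe (w : List ℕ) (j d : ℕ) : Prop :=
  DecLe w.reverse j d

theorem incLe_iff {w : List ℕ} {j d : ℕ} : IncLe w j d ↔
    ∃ s : List ℕ, s.Sublist w ∧ s.Pairwise (· < ·) ∧ (∀ x ∈ s, x ≤ j) ∧ s.length = d := by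
  constructor <;> rintro ⟨s, h₁, h₂, h₃, h₄⟩ <;> refine ⟨s.reverse, ?_, ?_, ?_, ?_⟩
  · simpa using h₁.reverse
  · simpa [List.pairwise_reverse] using h₂
  · simpa using h₃
  · simpa using h₄
  · simpa using h₁
  · simpa [List.pairwise_reverse] using h₂
  · simpa using h₃
  · simpa using h₄

theorem sublist_swap {A B s : List ℕ} {p q : ℕ} (h : s.Sublist (A ++ p :: q :: B)) :
    s.Sublist (A ++ q :: p :: B) ∨
      ∃ s₁ s₂, s = s₁ ++ p :: q :: s₂ ∧ s₁.Sublist A ∧ s₂.Sublist B := by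
  obtain ⟨s₁, s₂, rfl, h₁, h₂⟩ := List.sublist_append_iff.1 h
  rcases List.sublist_cons_iff.1 h₂ with h₃ | ⟨t, rfl, h₃⟩
  · left
    refine h₁.append ?_
    rcases List.sublist_cons_iff.1 h₃ with h₄ | ⟨t, rfl, h₄⟩
    · exact (h₄.cons _).cons _
    · exact (h₄.cons _).cons_cons _
  · rcases List.sublist_cons_iff.1 h₃ with h₄ | ⟨t, rfl, h₄⟩
    · left
      exact h₁.append ((h₄.cons_cons _).cons _)
    · exact Or.inr ⟨s₁, t, rfl, h₁, h₄⟩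

/-- A decreasing subsequence cannot use both letters of an ascent, so it survives the swap. This is
the source of all monotonicity along the weak order. -/
theorem DecLe.swap {A B : List ℕ} {a b j d : ℕ} (hab : a < b) (h : DecLe (A ++ a :: b :: B) j d) :
    DecLe (A ++ b :: a :: B) j d := by
  obtain ⟨s, h₁, h₂, h₃, h₄⟩ := h
  rcases sublist_swap h₁ with h₁ | ⟨s₁, s₂, rfl, -, -⟩
  · exact ⟨s, h₁, h₂, h₃, h₄⟩
  · simp only [List.pairwise_append, List.pairwise_cons, List.mem_cons] at h₂
    have := h₂.2.1.1 b (by simp)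
    omega

theorem IncLe.swap {A B : List ℕ} {a b j d : ℕ} (hab : a < b) (h : IncLe (A ++ b :: a :: B) j d) :
    IncLe (A ++ a :: b :: B) j d := by
  have h' : DecLe (B.reverse ++ a :: b :: A.reverse) j d := by simpa [IncLe] using h
  simpa [IncLe] using h'.swap hab

/-- A decreasing subsequence destroyed by a move contains both `z` and `x`, and `y` can replace one
of them. The bound `j` is kept because `y < z ≤ j`, and `y` is not used already because the other
letters are larger than `z` or smaller than `x`. -/
theorem Knuth.decLe_iff {v w : List ℕ} (h : Knuth v w) {j d : ℕ} :
    DecLe v j d ↔ DecLe w j d := by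
  induction h with
  | refl w => rfl
  | symm _ ih => exact ih.symm
  | trans _ _ ih₁ ih₂ => exact ih₁.trans ih₂
  | @yxz A B x y z hxy hyz =>
    constructor
    · intro h
      have h' : DecLe ((A ++ [y]) ++ x :: z :: B) j d := by simpa using h
      simpa using h'.swap (hxy.trans hyz)
    · rintro ⟨s, h₁, h₂, h₃, h₄⟩
      have h₁' : s.Sublist ((A ++ [y]) ++ z :: x :: B) := by simpa using h₁
      rcases sublist_swap h₁' with h | ⟨s₁, s₂, rfl, hs₁, hs₂⟩
      · exact ⟨s, by simpa using h, h₂, h₃, h₄⟩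
      · have hs₁A : s₁.Sublist A := by
          obtain ⟨t₁, t₂, rfl, h₅, h₆⟩ := List.sublist_append_iff.1 hs₁
          rcases List.sublist_cons_iff.1 h₆ with h₆ | ⟨t, rfl, -⟩
          · simpa [List.sublist_nil.1 h₆] using h₅
          · simp only [List.pairwise_append, List.mem_append, List.mem_cons] at h₂
            have := h₂.2.2 y (by simp) z (by simp)
            omega
        refine ⟨s₁ ++ y :: x :: s₂, hs₁A.append ((hs₂.cons z).cons_cons x |>.cons_cons y), ?_, ?_, ?_⟩
        · simp only [List.pairwise_append, List.pairwise_cons, List.mem_cons,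
            forall_eq_or_imp] at h₂ ⊢
          refine ⟨h₂.1, ⟨⟨hxy, fun a ha => (h₂.2.1.2.1 a ha).trans hxy⟩, h₂.2.1.2⟩, fun a ha => ?_⟩
          have := h₂.2.2 a ha
          exact ⟨hyz.trans this.1, this.2⟩
        · simp only [List.mem_append, List.mem_cons, or_imp, forall_and, forall_eq] at h₃ ⊢
          exact ⟨h₃.1, hyz.le.trans h₃.2.1, h₃.2.2⟩
        · simpa using h₄
  | @xzy A B x y z hxy hyz =>
    constructor
    · exact fun h => h.swap (hxy.trans hyz)
    · rintro ⟨s, h₁, h₂, h₃, h₄⟩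
      rcases sublist_swap h₁ with h | ⟨s₁, s₂, rfl, hs₁, hs₂⟩
      · exact ⟨s, h, h₂, h₃, h₄⟩
      · have hs₂B : s₂.Sublist B := by
          rcases List.sublist_cons_iff.1 hs₂ with h | ⟨t, rfl, -⟩
          · exact h
          · simp only [List.pairwise_append, List.pairwise_cons, List.mem_cons] at h₂
            have := h₂.2.1.2.1 y (by simp)
            omega
        refine ⟨s₁ ++ z :: y :: s₂, hs₁.append ((hs₂B.cons_cons y |>.cons_cons z).cons x), ?_, ?_, ?_⟩
        · simp only [List.pairwise_append, List.pairwise_cons, List.mem_cons,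
            forall_eq_or_imp] at h₂ ⊢
          refine ⟨h₂.1, ⟨⟨hyz, h₂.2.1.1.2⟩, fun a ha => (h₂.2.1.2.1 a ha).trans hxy,
            h₂.2.1.2.2⟩, fun a ha => ?_⟩
          have := h₂.2.2 a ha
          exact ⟨this.1, hyz.trans this.1, this.2.2⟩
        · simp only [List.mem_append, List.mem_cons, or_imp, forall_and, forall_eq] at h₃ ⊢
          exact ⟨h₃.1, h₃.2.1, hyz.le.trans h₃.2.1, h₃.2.2.2⟩
        · simpa using h₄

theorem Knuth.incLe_iff {v w : List ℕ} (h : Knuth v w) {j d : ℕ} :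
    IncLe v j d ↔ IncLe w j d :=
  h.reverse.decLe_iff

theorem length_le_one_of_sublist {r s : List ℕ} (hr : r.Pairwise (· ≤ ·)) (h : s.Sublist r)
    (hs : s.Pairwise (· > ·)) : s.length ≤ 1 := by
  rcases s with _ | ⟨a, _ | ⟨b, s⟩⟩
  · simp
  · simp
  · have h₁ := hr.sublist h
    simp only [List.pairwise_cons, List.mem_cons] at h₁ hs
    have := h₁.1 b (by simp)
    have := hs.1 b (by simp)
    omega

theorem DecLe.mono {w : List ℕ} {j d d' : ℕ} (h : DecLe w j d) (hd : d' ≤ d) : DecLe w j d' := by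
  obtain ⟨s, h₁, h₂, h₃, h₄⟩ := h
  have := List.take_sublist d' s
  exact ⟨s.take d', this.trans h₁, h₂.sublist this, fun x hx => h₃ x (this.subset hx),
    by rw [List.length_take]; omega⟩

/-- A decreasing subsequence meets every row at most once, and the first column read upwards is the
extreme example. Hence the entries of the first column are determined by `DecLe`. -/
theorem IsTableau.decLe_iff {T : List (List ℕ)} (hT : IsTableau T) {j i : ℕ} :
    DecLe (readingWord T) j (i + 1) ↔ ∃ e ∈ (T.getD i []).head?, e ≤ j := by
  induction T generalizing i with
  | nil =>
    simp only [readingWord, List.getD_nil, List.head?_nil, Option.mem_def, reduceCtorEq,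
      false_and, exists_false, iff_false]
    rintro ⟨s, h₁, -, -, h₄⟩
    rw [List.sublist_nil.1 h₁] at h₄
    simp at h₄
  | cons r rs ih =>
    rcases r with _ | ⟨a, r⟩
    · exact absurd rfl hT.1
    constructor
    · rintro ⟨s, h₁, h₂, h₃, h₄⟩
      rcases i with _ | i
      · rcases s with _ | ⟨e, s⟩
        · simp at h₄
        · have h := hT.le_of_mem e (h₁.subset (by simp))
          exact ⟨a, by simp, h.trans (h₃ e (by simp))⟩
      · obtain ⟨s₁, s₂, rfl, h₅, h₆⟩ := List.sublist_append_iff.1 h₁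
        have h₇ := List.pairwise_append.1 h₂
        have h₈ := length_le_one_of_sublist hT.2.1 h₆ h₇.2.1
        rw [List.length_append] at h₄
        have : DecLe (readingWord rs) j s₁.length :=
          ⟨s₁, h₅, h₇.1, fun x hx => h₃ x (by simp [hx]), rfl⟩
        simpa using (ih hT.2.2.2).1 (this.mono (show i + 1 ≤ _ by omega))
    · rcases i with _ | i
      · rintro ⟨e, h₁, h₂⟩
        simp only [List.getD_cons_zero, List.head?_cons, Option.mem_def, Option.some.injEq] at h₁
        subst h₁
        exact ⟨[a], by simp [readingWord], by simp, by simpa using h₂, rfl⟩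
      · rw [List.getD_cons_succ, ← ih hT.2.2.2]
        rintro ⟨s, h₁, h₂, h₃, h₄⟩
        have ha : ∀ x ∈ s, a < x := fun x hx => hT.lt_of_mem x (h₁.subset hx)
        refine ⟨s ++ [a], h₁.append (by simp), ?_, ?_, by simp [h₄]⟩
        · rw [List.pairwise_append]
          exact ⟨h₂, by simp, by simpa using ha⟩
        · rcases s with _ | ⟨e, s⟩
          · simp at h₄
          · have := (ha e (by simp)).le.trans (h₃ e (by simp))
            intro x hx
            rw [List.mem_append, List.mem_singleton] at hx
            rcases hx with hx | rfl
            · exact h₃ x hx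
            · exact this

/-- The first letter `c ≤ b` of the reading word of a tableau: the longest decreasing
subsequences with letters at most `b` and at most `c` have the same length. -/
theorem IsTableau.exists_first_le {T : List (List ℕ)} (hT : IsTableau T) (b : ℕ) :
    (∀ x ∈ readingWord T, b < x) ∨ ∃ X c B, readingWord T = X ++ c :: B ∧ c ≤ b ∧
      (∀ x ∈ X, b < x) ∧ ∀ d, DecLe (readingWord T) b d → DecLe (readingWord T) c d := by
  induction T with
  | nil => simp [readingWord]
  | cons r rs ih =>
    rcases r with _ | ⟨a, r⟩
    · exact absurd rfl hT.1
    -- The letter `c` is the head of the lowest row whose head is at most `b`. Each row above it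
    -- adds at most one letter to a decreasing subsequence, and its head always adds one.
    rcases ih hT.2.2.2 with h | ⟨X, c, B, h₁, h₂, h₃, h₄⟩
    · rcases lt_or_ge b a with hb | hb
      · exact Or.inl fun x hx => hb.trans_le (hT.le_of_mem x hx)
      · refine Or.inr ⟨readingWord rs, a, r, rfl, hb, h, ?_⟩
        rintro d ⟨s, h₁, h₂, h₃, rfl⟩
        obtain ⟨s₁, s₂, rfl, h₅, h₆⟩ := List.sublist_append_iff.1 h₁
        rcases s₁ with _ | ⟨e, s₁⟩
        · have : DecLe (readingWord ((a :: r) :: rs)) a 1 :=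
            ⟨[a], by simp [readingWord], by simp, by simp, rfl⟩
          exact this.mono (length_le_one_of_sublist hT.2.1 h₆ h₂)
        · have h₇ := h e (h₅.subset (by simp))
          have h₈ := h₃ e (by simp)
          omega
    · refine Or.inr ⟨X, c, B ++ (a :: r), by simp [readingWord, h₁], h₂, h₃, ?_⟩
      rintro d ⟨s, h₅, h₆, h₇, rfl⟩
      obtain ⟨s₁, s₂, rfl, h₈, h₉⟩ := List.sublist_append_iff.1 h₅
      have h₁₀ := List.pairwise_append.1 h₆
      obtain ⟨s, g₁, g₂, g₃, g₄⟩ :=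
        h₄ s₁.length ⟨s₁, h₈, h₁₀.1, fun x hx => h₇ x (by simp [hx]), rfl⟩
      have : DecLe (readingWord ((a :: r) :: rs)) c (s.length + 1) := by
        refine ⟨s ++ [a], g₁.append (by simp), ?_, ?_, by simp⟩
        · rw [List.pairwise_append]
          exact ⟨g₂, by simp, by simpa using fun x hx => hT.lt_of_mem x (g₁.subset hx)⟩
        · intro x hx
          rw [List.mem_append, List.mem_singleton] at hx
          rcases hx with hx | rfl
          · exact g₃ x hx
          · exact (hT.lt_of_mem c (by simp [h₁])).le
      refine this.mono ?_
      have := length_le_one_of_sublist hT.2.1 h₉ h₁₀.2.1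
      rw [List.length_append]
      omega

theorem Dominates.countP_le {r s : List ℕ} (h : Dominates r s) (m : ℕ) :
    s.countP (· ≤ m) ≤ r.countP (· ≤ m) := by
  induction r generalizing s with
  | nil =>
    rcases s with _ | ⟨b, s⟩
    · simp
    · exact h.elim
  | cons a r ih =>
    rcases s with _ | ⟨b, s⟩
    · simp
    · obtain ⟨h₁, h₂⟩ := h
      have := ih h₂
      simp only [List.countP_cons, decide_eq_true_eq]
      split_ifs <;> omega

theorem countP_add_le (f m : ℕ) (h : f ≤ m) (r : List ℕ) :
    r.countP (· < f) + r.countP (fun x => f ≤ x ∧ x ≤ m) ≤ r.countP (· ≤ m) := by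
  induction r with
  | nil => simp
  | cons a r ih =>
    simp only [List.countP_cons, decide_eq_true_eq]
    split_ifs <;> omega

/-- Let `f` be the first letter taken from the top row. The letters taken from lower rows are below
`f`, and by induction and domination there are at most as many of them as letters below `f` in the
top row. The others are letters of the top row between `f` and `m`. -/
theorem IsTableau.length_le_of_increasing {T : List (List ℕ)} (hT : IsTableau T) {m : ℕ}
    {s : List ℕ} (h : s.Sublist (readingWord T)) (hs : s.Pairwise (· < ·))
    (hm : ∀ x ∈ s, x ≤ m) : s.length ≤ (T.headD []).countP (· ≤ m) := by
  induction T generalizing s m with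
  | nil => simp [List.sublist_nil.1 h]
  | cons r rs ih =>
    obtain ⟨s₁, s₂, rfl, h₁, h₂⟩ := List.sublist_append_iff.1 h
    have h₃ := List.pairwise_append.1 hs
    have hr : ∀ m, (rs.headD []).countP (· ≤ m) ≤ r.countP (· ≤ m) := hT.2.2.1.countP_le
    rcases s₂ with _ | ⟨f, s₂⟩
    · rw [List.append_nil] at hm ⊢
      exact (ih hT.2.2.2 h₁ h₃.1 hm).trans (hr m)
    · have h₄ : (f :: s₂).length ≤ r.countP (fun x => f ≤ x ∧ x ≤ m) := by
        refine le_trans (le_of_eq ?_) h₂.countP_le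
        symm
        rw [List.countP_eq_length]
        intro x hx
        have h₅ := hm x (by simp [List.mem_append, hx])
        rw [List.mem_cons] at hx
        rcases hx with rfl | hx
        · simpa using h₅
        · simpa [h₅] using ((List.pairwise_cons.1 h₃.2.1).1 x hx).le
      have h₅ : s₁.length ≤ r.countP (· < f) := by
        -- The induction hypothesis is used with the bound `f - 1`, which makes `f = 0` a separate
        -- case.
        rcases f with _ | f
        · rcases s₁ with _ | ⟨e, s₁⟩
          · simp
          · have := h₃.2.2 e (by simp) 0 (by simp)
            omega
        · have := (ih hT.2.2.2 h₁ h₃.1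
            fun x hx => Nat.lt_succ_iff.1 (h₃.2.2 x hx (f + 1) (by simp))).trans (hr f)
          simpa only [Nat.lt_succ_iff] using this
      have h₆ := countP_add_le f m (hm f (by simp)) r
      rw [List.length_append]
      exact (Nat.add_le_add h₅ h₄).trans h₆

/-! ### Rearrangements by Knuth equivalences -/

/-- Insert the letters of `X` one after the other in the row starting with `c`. The minimal letter
`c` is never bumped, and the bumped letters collect in `α`. -/
theorem knuth_cons_of_lt {c : ℕ} {X : List ℕ} (hX : ∀ x ∈ X, c < x) (hn : X.Nodup) :
    ∃ α R, Knuth (c :: X) (α ++ c :: R) ∧ (c :: R).Pairwise (· < ·) ∧ (α ++ R).Perm X := by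
  induction X using List.reverseRecOn with
  | nil => exact ⟨[], [], .refl _, by simp, by simp⟩
  | append_singleton X y ih =>
    have hy := List.nodup_append.1 hn
    obtain ⟨α, R, h₁, h₂, h₃⟩ := ih (fun x hx => hX x (by simp [hx])) hy.1
    have hcy : c < y := hX y (by simp)
    have hyR : y ∉ c :: R := by
      rw [List.mem_cons, not_or]
      exact ⟨hcy.ne', fun h => hy.2.2 y (h₃.subset (by simp [h])) y (by simp) rfl⟩
    obtain ⟨h₄, h₅, -⟩ := knuth_rowInsert h₂ hyR
    rw [rowInsert_of_le R hcy.le] at h₄ h₅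
    refine ⟨α ++ (rowInsert R y).2.toList, (rowInsert R y).1, ?_, h₅, ?_⟩
    · simpa using (h₁.append_right [y]).trans (by simpa using h₄.append_left α)
    · rw [List.append_assoc]
      refine ((rowInsert_perm R y).append_left α).trans ?_
      exact List.perm_middle.trans ((h₃.cons y).trans (List.perm_append_singleton y X).symm)

/-- After `c X` is brought to the form `α c R` with `c R` increasing, either `R` is empty and `c`
itself is the witness for a Knuth move on `a, b`, or the head `x` of `R` lets both words be brought
to contain `a b` in this order. The difference then reappears as the order of `c` and `x`. -/
theorem knuth_rearrange_left {a b c : ℕ} (hac : a < c) (hcb : c < b) {X : List ℕ}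
    (hX : ∀ x ∈ X, b < x) (hn : X.Nodup) :
    Knuth (c :: X ++ [a, b]) (c :: X ++ [b, a]) ∨ ∃ α x β, b < x ∧
      Knuth (c :: X ++ [a, b]) (α ++ c :: x :: a :: b :: β) ∧
      Knuth (c :: X ++ [b, a]) (α ++ x :: c :: a :: b :: β) := by
  obtain ⟨α, R, h₁, h₂, h₃⟩ := knuth_cons_of_lt (fun x hx => hcb.trans (hX x hx)) hn
  rcases R with _ | ⟨x, β⟩
  · left
    refine (h₁.append_right [a, b]).trans (.trans ?_ (h₁.append_right [b, a]).symm)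
    simpa using Knuth.yxz α [] hac hcb
  · right
    have hbR : ∀ y ∈ x :: β, b < y := fun y hy => hX y (h₃.subset (List.mem_append_right _ hy))
    have hbx : b < x := hbR x (by simp)
    have hR := (List.pairwise_cons.1 h₂).2
    have hxb : Knuth (x :: (β ++ [b])) (x :: b :: β) := .cons_sorted_append_singleton hR hbx
    refine ⟨α, x, β, hbx, (h₁.append_right [a, b]).trans ?_, (h₁.append_right [b, a]).trans ?_⟩
    · have e₁ : Knuth (c :: (x :: β ++ [a])) (c :: a :: x :: β) :=
        .cons_sorted_append_singleton h₂ hac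
      have e₂ : Knuth (a :: x :: b :: β) (x :: a :: b :: β) :=
        .xzy [] β (hac.trans hcb) hbx
      have e₃ := (e₁.append_right [b]).trans
        (.trans (by simpa using (hxb.cons a).cons c) (e₂.cons c))
      simpa using e₃.append_left α
    · have e₁ : Knuth (c :: x :: b :: β) (x :: c :: b :: β) := .xzy [] β hcb hbx
      have hc : (c :: b :: β).Pairwise (· < ·) := by
        rw [List.pairwise_cons] at hR
        simp only [List.pairwise_cons, List.mem_cons, forall_eq_or_imp]
        exact ⟨⟨hcb, fun y hy => hcb.trans (hbR y (by simp [hy]))⟩,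
          fun y hy => hbR y (by simp [hy]), hR.2⟩
      have e₂ : Knuth (c :: (b :: β ++ [a])) (c :: a :: b :: β) :=
        .cons_sorted_append_singleton hc hac
      have e₃ := (((hxb.cons c).trans e₁).append_right [a]).trans
        (by simpa using e₂.cons x)
      simpa using e₃.append_left α

theorem knuth_rearrange_right {a b c : ℕ} (hac : a < c) (hcb : c < b) {X : List ℕ}
    (hX : ∀ x ∈ X, b < x) (hn : X.Nodup) :
    Knuth (a :: b :: X ++ [c]) (b :: a :: X ++ [c]) ∨ ∃ α x β, b < x ∧
      Knuth (a :: b :: X ++ [c]) (α ++ b :: a :: c :: x :: β) ∧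
      Knuth (b :: a :: X ++ [c]) (α ++ b :: a :: x :: c :: β) := by
  rcases knuth_rearrange_left hac hcb (X := X.reverse) (by simpa using hX) (by simpa using hn) with
    h | ⟨α, x, β, hx, h₁, h₂⟩
  · left
    simpa using h.reverse.symm
  · right
    exact ⟨β.reverse, x, α.reverse, hx, by simpa using h₂.reverse, by simpa using h₁.reverse⟩

theorem exists_last_le (A : List ℕ) (b : ℕ) :
    (∀ x ∈ A, b < x) ∨ ∃ A' c X, A = A' ++ c :: X ∧ c ≤ b ∧ ∀ x ∈ X, b < x := by
  induction A with
  | nil => simp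
  | cons a A ih =>
    rcases ih with h | ⟨A', c, X, rfl, h₁, h₂⟩
    · rcases lt_or_ge b a with hb | hb
      · exact Or.inl (by simpa using ⟨hb, h⟩)
      · exact Or.inr ⟨[], a, A, rfl, hb, h⟩
    · exact Or.inr ⟨a :: A', c, X, rfl, h₁, h₂⟩

/-- If an ascent `a < b` is swapped and the restrictions to `[1, k]` of the insertion tableaux
have two columns and coincide, then the words are Knuth equivalent, or they can be
replaced by Knuth equivalent words which differ by the swap of an ascent `a' < b'` with
`k < b'`. -/
theorem exists_swap_large {k a b : ℕ} {A B : List ℕ} (hab : a < b)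
    (hn : (A ++ a :: b :: B).Nodup)
    (hdec : ∀ j ≤ k, ∀ d, DecLe (A ++ b :: a :: B) j d → DecLe (A ++ a :: b :: B) j d)
    (hinc : ¬ IncLe (A ++ a :: b :: B) k 3) :
    Knuth (A ++ a :: b :: B) (A ++ b :: a :: B) ∨ ∃ A' a' b' B', a' < b' ∧ k < b' ∧
      Knuth (A ++ a :: b :: B) (A' ++ a' :: b' :: B') ∧
      Knuth (A ++ b :: a :: B) (A' ++ b' :: a' :: B') := by
  by_cases hbk : k < b
  · exact Or.inr ⟨A, a, b, B, hab, hbk, .refl _, .refl _⟩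
  rw [not_lt] at hbk
  -- The recursive call, for a swap of `c, x` instead of `a, b`. Both hypotheses are invariant under
  -- Knuth equivalence, and `k - a` decreases because `a < c` and `a < b ≤ k`.
  have step : ∀ {A' c x B'}, a < c → c < x →
      Knuth (A ++ a :: b :: B) (A' ++ c :: x :: B') →
      Knuth (A ++ b :: a :: B) (A' ++ x :: c :: B') →
      Knuth (A ++ a :: b :: B) (A ++ b :: a :: B) ∨ ∃ A' a' b' B', a' < b' ∧ k < b' ∧
        Knuth (A ++ a :: b :: B) (A' ++ a' :: b' :: B') ∧
        Knuth (A ++ b :: a :: B) (A' ++ b' :: a' :: B') := by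
    intro A' c x B' hac hcx h₁ h₂
    have := exists_swap_large (k := k) (a := c) (b := x) (A := A') (B := B') hcx
      (h₁.perm.nodup_iff.1 hn)
      (fun j hj d hd => h₁.decLe_iff.1 (hdec j hj d (h₂.decLe_iff.2 hd)))
      (fun h => hinc (h₁.incLe_iff.2 h))
    rcases this with h | ⟨A'', a', b', B'', h₃, h₄, h₅, h₆⟩
    · exact Or.inl (h₁.trans (h.trans h₂.symm))
    · exact Or.inr ⟨A'', a', b', B'', h₃, h₄, h₁.trans h₅, h₂.trans h₆⟩
  have hnA := List.nodup_append.1 hn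
  have hnB := List.nodup_cons.1 hnA.2.1
  have hnB' := List.nodup_cons.1 hnB.2
  -- The witness `c` is the last letter `≤ b` before the pair, if there is one. Otherwise it has to
  -- be found in `B`.
  rcases exists_last_le A b with hA | ⟨A', c, X, rfl, hcb, hX⟩
  · have hBn := knuth_readingWord hnB'.2
    -- A decreasing subsequence of `B` with letters `≤ a` can be prolonged by `b a` after the swap.
    -- Before the swap, a decreasing subsequence with letters `≤ b` avoids `A` and uses at most one
    -- of `a`, `b`. By `hdec`, the longest one in `B` with letters `≤ b` is therefore strictly
    -- longer than the longest one with letters `≤ a`.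
    have hcount : ∀ d, DecLe B a d → ¬ DecLe B b (d + 1) → (∀ x ∈ B, x ≠ a) → False := by
      rintro d ⟨s, h₁, h₂, h₃, rfl⟩ h₄ h₅
      have h₃' : ∀ x ∈ s, x < a := fun x hx =>
        lt_of_le_of_ne (h₃ x hx) (h₅ x (h₁.subset hx))
      obtain ⟨t, g₁, g₂, g₃, g₄⟩ := hdec b hbk (s.length + 2)
        ⟨b :: a :: s, (h₁.cons_cons a |>.cons_cons b).trans (List.sublist_append_right _ _),
          by
            simp only [List.pairwise_cons, List.mem_cons, forall_eq_or_imp]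
            exact ⟨⟨hab, fun x hx => (h₃' x hx).trans hab⟩, h₃', h₂⟩,
          by
            simp only [List.mem_cons, forall_eq_or_imp]
            exact ⟨le_rfl, hab.le, fun x hx => ((h₃' x hx).trans hab).le⟩, by simp⟩
      obtain ⟨t₁, t₂, rfl, g₅, g₆⟩ := List.sublist_append_iff.1 g₁
      rcases t₁ with _ | ⟨e, t₁⟩
      swap
      · have := hA e (g₅.subset (by simp))
        have := g₃ e (by simp)
        omega
      rw [List.nil_append] at g₂ g₃ g₄
      have aux : ∀ t : List ℕ, t.Sublist B → t.Pairwise (· > ·) → (∀ x ∈ t, x ≤ b) →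
          t.length ≤ s.length := by
        intro t k₁ k₂ k₃
        by_contra hlt
        exact h₄ (DecLe.mono ⟨t, k₁, k₂, k₃, rfl⟩ (by omega))
      rcases List.sublist_cons_iff.1 g₆ with g₇ | ⟨t, rfl, g₇⟩ <;>
        rcases List.sublist_cons_iff.1 g₇ with g₈ | ⟨t, rfl, g₈⟩
      · have := aux _ g₈ g₂ g₃
        omega
      · have := aux _ g₈ (List.pairwise_cons.1 g₂).2 (fun x hx => g₃ x (by simp [hx]))
        simp only [List.length_cons] at g₄
        omega
      · have := aux _ g₈ (List.pairwise_cons.1 g₂).2 (fun x hx => g₃ x (by simp [hx]))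
        simp only [List.length_cons] at g₄
        omega
      · have := (List.pairwise_cons.1 g₂).1 b (by simp)
        omega
    have haB : ∀ x ∈ B, x ≠ a := by
      rintro x hx rfl
      exact hnB.1 (by simp [hx])
    rcases (isTableau_insertionRows B).exists_first_le b with hB | ⟨X, c, B', h₁, h₂, h₃, h₄⟩
    · refine (hcount 0 ⟨[], by simp⟩ ?_ haB).elim
      rintro ⟨s, h₁, -, h₃, h₄⟩
      rcases s with _ | ⟨e, s⟩
      · simp at h₄
      · have := hB e ((readingWord_insertionRows_perm B).symm.subset (h₁.subset (by simp)))
        have := h₃ e (by simp)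
        omega
    · have hcB : c ∈ B := (readingWord_insertionRows_perm B).subset (by simp [h₁])
      have hcb : c < b := lt_of_le_of_ne h₂ (by rintro rfl; exact hnB'.1 hcB)
      have hac : a < c := by
        by_contra hca
        have hall : ∀ e, DecLe B b e := by
          intro e
          induction e with
          | zero => exact ⟨[], by simp⟩
          | succ e ih =>
            by_contra he
            obtain ⟨s, k₁, k₂, k₃, k₄⟩ := hBn.1.decLe_iff.2 (h₄ e (hBn.1.decLe_iff.1 ih))
            exact hcount e ⟨s, k₁, k₂, fun x hx => (k₃ x hx).trans (not_lt.1 hca), k₄⟩ he haB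
        obtain ⟨s, k₁, -, -, k₄⟩ := hall (B.length + 1)
        have := k₁.length_le
        omega
      have hXn : X.Nodup := by
        have := (readingWord_insertionRows_perm B).nodup_iff.2 hnB'.2
        rw [h₁] at this
        exact (List.nodup_append.1 this).1
      have hK := hBn.1
      rw [h₁] at hK
      have e₁ := (((hK.cons b).cons a).append_left A)
      have e₂ := (((hK.cons a).cons b).append_left A)
      rcases knuth_rearrange_right hac hcb h₃ hXn with h | ⟨α, x, β, hbx, f₁, f₂⟩
      · left
        refine e₁.trans (.trans ?_ e₂.symm)
        simpa using h.context A B'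
      · refine step (A' := A ++ α ++ [b, a]) (c := c) (x := x) (B' := β ++ B') hac (hcb.trans hbx)
          (e₁.trans ?_) (e₂.trans ?_)
        · simpa using f₁.context A B'
        · simpa using f₂.context A B'
  · have hcb' : c < b := lt_of_le_of_ne hcb (by
      rintro rfl
      exact hnA.2.2 c (by simp) c (by simp) rfl)
    -- Otherwise `c a b` is an increasing subsequence of three letters `≤ k`, which two columns
    -- exclude.
    have hac : a < c := by
      by_contra hca
      have : c ≠ a := by
        rintro rfl
        exact hnA.2.2 c (by simp) c (by simp) rfl
      have hca' : c < a := by omega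
      refine hinc (incLe_iff.2 ⟨[c, a, b], ?_, ?_, ?_, rfl⟩)
      · rw [List.append_assoc]
        refine .trans ?_ (List.sublist_append_right _ _)
        rw [List.cons_append]
        refine List.Sublist.cons_cons _ (.trans ?_ (List.sublist_append_right _ _))
        simp
      · simp [hca', hab, hca'.trans hab]
      · simp only [List.mem_cons, List.not_mem_nil, or_false, forall_eq_or_imp, forall_eq]
        omega
    have hXn : X.Nodup := by
      have := (List.nodup_append.1 hnA.1).2.1
      exact (List.nodup_cons.1 this).2
    rcases knuth_rearrange_left hac hcb' hX hXn with h | ⟨α, x, β, hbx, f₁, f₂⟩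
    · left
      simpa using h.context A' B
    · refine step (A' := A' ++ α) (c := c) (x := x) (B' := a :: b :: β ++ B) hac (hcb'.trans hbx)
        ?_ ?_
      · simpa using f₁.context A' B
      · simpa using f₂.context A' B
termination_by k - a

/-! ### Reversing an insertion -/

theorem rowInsert_length (r : List ℕ) (x : ℕ) :
    (rowInsert r x).2.toList.length + (rowInsert r x).1.length = r.length + 1 := by
  simpa using (rowInsert_perm r x).length_eq

theorem rowInsert_of_eq_none {r : List ℕ} {x : ℕ} (h : (rowInsert r x).2 = none) :
    (rowInsert r x).1 = r ++ [x] := by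
  induction r with
  | nil => rfl
  | cons a r ih =>
    rcases lt_or_ge x a with hx | hx
    · simp [rowInsert_of_lt r hx] at h
    · rw [rowInsert_of_le r hx] at h ⊢
      simp [ih h]

theorem rowInsert_of_forall_le {r : List ℕ} {x : ℕ} (h : ∀ y ∈ r, y ≤ x) :
    rowInsert r x = (r ++ [x], none) := by
  induction r with
  | nil => rfl
  | cons a r ih =>
    rw [List.forall_mem_cons] at h
    rw [rowInsert_of_le r h.1, ih h.2, List.cons_append]

theorem Dominates.length_le {r s : List ℕ} (h : Dominates r s) : s.length ≤ r.length := by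
  induction r generalizing s with
  | nil =>
    rcases s with _ | ⟨b, s⟩
    · simp
    · exact h.elim
  | cons a r ih =>
    rcases s with _ | ⟨b, s⟩
    · simp
    · simpa using ih h.2

theorem Dominates.of_append {r s t : List ℕ} (h : Dominates (r ++ t) s)
    (hl : s.length ≤ r.length) : Dominates r s := by
  induction r generalizing s with
  | nil =>
    rw [List.length_nil, Nat.le_zero, List.length_eq_zero_iff] at hl
    rw [hl]
    exact .nil _
  | cons a r ih =>
    rcases s with _ | ⟨b, s⟩
    · exact .nil _
    · exact ⟨h.1, ih h.2 (by simpa using hl)⟩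

theorem rowInsert_cons_of_eq {a x y : ℕ} {r t : List ℕ} (ht : (a :: t).Pairwise (· ≤ ·))
    (hay : a ≤ y) (hr : r.Pairwise (· ≤ ·)) (h : rowInsert r x = (t, some y)) :
    rowInsert (a :: r) x = (a :: t, some y) ∧ (a :: r).Pairwise (· ≤ ·) := by
  have hp := rowInsert_perm r x
  rw [h] at hp
  have key : ∀ z ∈ x :: r, a ≤ z := by
    intro z hz
    have := hp.symm.subset hz
    simp only [Option.toList, List.cons_append, List.nil_append, List.mem_cons] at this
    rcases this with rfl | hz
    · exact hay
    · exact (List.pairwise_cons.1 ht).1 z hz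
  rw [List.forall_mem_cons] at key
  rw [rowInsert_of_le r key.1, h]
  exact ⟨rfl, List.pairwise_cons.2 ⟨key.2, hr⟩⟩

/-- Reverse bumping: `x` is the last entry smaller than `y`, and `y` returns to its place. The new
row still dominates `s`, since the entries of `s` are larger than `y`. -/
theorem exists_rowInsert_eq_of_lt {a y : ℕ} {t s : List ℕ} (ht : (a :: t).Pairwise (· ≤ ·))
    (ha : a < y) (hs : ∀ x ∈ s, y < x) (hd : Dominates (a :: t) s) :
    ∃ r x, rowInsert r x = (a :: t, some y) ∧ r.Pairwise (· ≤ ·) ∧ Dominates r s := by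
  induction t generalizing a s with
  | nil =>
    refine ⟨[y], a, rowInsert_of_lt _ ha, by simp, ?_⟩
    rcases s with _ | ⟨b, s⟩
    · exact .nil _
    · exact ⟨hs b (by simp), hd.2⟩
  | cons f t ih =>
    rcases lt_or_ge f y with hf | hf
    · have hd' : Dominates (f :: t) s.tail := by
        rcases s with _ | ⟨b, s⟩
        · exact .nil _
        · exact hd.2
      obtain ⟨r, x, h₁, h₂, h₃⟩ := ih (List.pairwise_cons.1 ht).2 hf
        (fun x hx => hs x (List.mem_of_mem_tail hx)) hd'
      obtain ⟨h₄, h₅⟩ := rowInsert_cons_of_eq ht ha.le h₂ h₁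
      refine ⟨a :: r, x, h₄, h₅, ?_⟩
      rcases s with _ | ⟨b, s⟩
      · exact .nil _
      · exact ⟨hd.1, h₃⟩
    · refine ⟨y :: f :: t, a, rowInsert_of_lt _ ha, ?_, ?_⟩
      · have := (List.pairwise_cons.1 ht).2
        refine List.pairwise_cons.2 ⟨?_, this⟩
        rw [List.forall_mem_cons]
        exact ⟨hf, fun z hz => hf.trans ((List.pairwise_cons.1 this).1 z hz)⟩
      · rcases s with _ | ⟨b, s⟩
        · exact .nil _
        · exact ⟨hs b (by simp), hd.2⟩

/-- Here `s` is the lower row before `y` arrived in it. The letter above the landing place of `y` is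
smaller than `y`, so `y` returns to that column or further right, where the entries of `s` are
larger than `y`. -/
theorem exists_rowInsert_eq {t s : List ℕ} {y : ℕ} (ht : t.Pairwise (· ≤ ·))
    (hs : s.Pairwise (· ≤ ·)) (hd : Dominates t (rowInsert s y).1) :
    ∃ r x, rowInsert r x = (t, some y) ∧ r.Pairwise (· ≤ ·) ∧ Dominates r s := by
  induction s generalizing t with
  | nil =>
    rcases t with _ | ⟨a, t⟩
    · exact hd.elim
    · exact exists_rowInsert_eq_of_lt ht hd.1 (by simp) (.nil _)
  | cons b s ih =>
    rcases t with _ | ⟨a, t⟩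
    · rcases lt_or_ge y b with hb | hb
      · rw [rowInsert_of_lt s hb] at hd
        exact hd.elim
      · rw [rowInsert_of_le s hb] at hd
        exact hd.elim
    rw [List.pairwise_cons] at hs
    rcases lt_or_ge y b with hb | hb
    · rw [rowInsert_of_lt s hb] at hd
      refine exists_rowInsert_eq_of_lt ht hd.1 ?_ ⟨hd.1.trans hb, hd.2⟩
      rw [List.forall_mem_cons]
      exact ⟨hb, fun x hx => hb.trans_le (hs.1 x hx)⟩
    · rw [rowInsert_of_le s hb] at hd
      obtain ⟨r, x, h₁, h₂, h₃⟩ := ih (List.pairwise_cons.1 ht).2 hs.2 hd.2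
      obtain ⟨h₄, h₅⟩ := rowInsert_cons_of_eq ht (hd.1.le.trans hb) h₂ h₁
      exact ⟨a :: r, x, h₄, h₅, hd.1, h₃⟩

theorem length_headD {S T : List (List ℕ)} (h : S.map List.length = T.map List.length) :
    (S.headD []).length = (T.headD []).length := by
  rcases S with _ | ⟨r, S⟩ <;> rcases T with _ | ⟨s, T⟩ <;> simp_all

theorem IsTableau.sorted_headD {T : List (List ℕ)} (h : IsTableau T) :
    (T.headD []).Pairwise (· ≤ ·) := by
  rcases T with _ | ⟨r, rs⟩
  · simp
  · exact h.2.1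

/-- An insertion can be reversed on every tableau which has the shape of its result. -/
theorem IsTableau.exists_tableauInsert_eq {T P : List (List ℕ)} (hT : IsTableau T)
    (hP : IsTableau P) {x : ℕ}
    (h : (TableauWeakOrder.tableauInsert T x).map List.length = P.map List.length) :
    ∃ T' x', IsTableau T' ∧ TableauWeakOrder.tableauInsert T' x' = P ∧
      T.map List.length = T'.map List.length := by
  induction T generalizing P x with
  | nil =>
    rcases P with _ | ⟨p, _ | ⟨p', P⟩⟩ <;> simp [TableauWeakOrder.tableauInsert] at h
    obtain ⟨x', rfl⟩ := List.length_eq_one_iff.1 h.symm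
    exact ⟨[], x', trivial, rfl, rfl⟩
  | cons r rs ih =>
    rcases P with _ | ⟨p, ps⟩
    · rw [TableauWeakOrder.tableauInsert] at h
      rcases h' : rowInsert r x with ⟨r', _ | y⟩ <;> simp [h'] at h
    have hl := rowInsert_length r x
    rw [TableauWeakOrder.tableauInsert] at h
    obtain ⟨hT₁, hT₂, hT₃, hT₄⟩ := hT
    obtain ⟨hP₁, hP₂, hP₃, hP₄⟩ := hP
    have hr := List.length_pos_of_ne_nil hT₁
    rcases h' : rowInsert r x with ⟨r', _ | y⟩ <;>
      simp only [h', List.map_cons, List.cons.injEq, Option.toList, List.length_nil,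
        List.length_singleton] at h hl
    -- The new cell is at the end of this row, so the last letter `z` is removed.
    · rcases List.eq_nil_or_concat' p with rfl | ⟨p, z, rfl⟩
      · exact absurd rfl hP₁
      rw [List.length_append, List.length_singleton] at h
      rw [List.pairwise_append] at hP₂
      refine ⟨p :: ps, z, ⟨?_, hP₂.1, hP₃.of_append ?_, hP₄⟩, ?_, ?_⟩
      · rintro rfl
        simp only [List.length_nil] at h
        omega
      · have := hT₃.length_le
        rw [length_headD h.2] at this
        omega
      · simp [TableauWeakOrder.tableauInsert,
          rowInsert_of_forall_le fun y hy => hP₂.2.2 y hy z (by simp)]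
      · simp only [List.map_cons, List.cons.injEq]
        exact ⟨by omega, h.2⟩
    -- The new cell lies lower. Undoing the insertion below releases `z`, which returns to the row
    -- `p` and releases `w`.
    · obtain ⟨Q, z, hQ, rfl, hQ'⟩ := ih hT₄ hP₄ h.2
      rw [headD_tableauInsert] at hP₃
      obtain ⟨q, w, h₁, h₂, h₃⟩ := exists_rowInsert_eq hP₂ hQ.sorted_headD hP₃
      have hl' := rowInsert_length q w
      simp only [h₁, Option.toList, List.length_singleton] at hl'
      refine ⟨q :: Q, w, ⟨?_, h₂, h₃, hQ⟩, by simp [TableauWeakOrder.tableauInsert, h₁], ?_⟩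
      · rintro rfl
        simp only [List.length_nil] at hl'
        omega
      · simp only [List.map_cons, List.cons.injEq]
        exact ⟨by omega, hQ'⟩

/-- Two words, given as a word of pairs, have the same recording tableau. -/
def SameRecording (v : List (ℕ × ℕ)) : Prop :=
  ∀ v', v' <+: v → (insertionRows (v'.map Prod.fst)).map List.length =
    (insertionRows (v'.map Prod.snd)).map List.length

/-- Surjectivity of the Robinson--Schensted correspondence: reverse the insertions on `P`, each time
emptying the cell that the corresponding letter of `u` has created. -/
theorem exists_sameRecording (u : List ℕ) {P : List (List ℕ)} (hP : IsTableau P)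
    (h : (insertionRows u).map List.length = P.map List.length) :
    ∃ v : List (ℕ × ℕ), v.map Prod.fst = u ∧ insertionRows (v.map Prod.snd) = P ∧
      SameRecording v := by
  induction u using List.reverseRecOn generalizing P with
  | nil =>
    have : P = [] := by simpa [insertionRows] using h.symm
    subst this
    refine ⟨[], rfl, rfl, ?_⟩
    intro v' hv'
    simp [List.prefix_nil.1 hv']
  | append_singleton u x ih =>
    have h₀ := h
    rw [insertionRows_append_singleton] at h
    obtain ⟨T, x', hT, rfl, h₁⟩ := (isTableau_insertionRows u).exists_tableauInsert_eq hP h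
    obtain ⟨v, rfl, rfl, h₂⟩ := ih hT h₁
    refine ⟨v ++ [(x, x')], by simp, by simp [insertionRows_append_singleton], ?_⟩
    intro v' hv'
    rcases List.prefix_concat_iff.1 hv' with rfl | hv'
    · simpa [insertionRows_append_singleton] using h
    · exact h₂ v' hv'

/-! ### Replacing the small letters of a word -/

/-- The tableaux `T` and `T'` arise from `P` and `P'` by adding the same letters larger than `k`
at the ends of the rows. -/
inductive SameOuter (k : ℕ) :
    List (List ℕ) → List (List ℕ) → List (List ℕ) → List (List ℕ) → Prop
  | nil : SameOuter k [] [] [] []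
  | cons {p p' q : List ℕ} {T T' P P' : List (List ℕ)} (hl : p.length = p'.length)
      (hp : ∀ x ∈ p, x ≤ k) (hp' : ∀ x ∈ p', x ≤ k) (hq : ∀ x ∈ q, k < x)
      (h : SameOuter k T T' P P') :
      SameOuter k ((p ++ q) :: T) ((p' ++ q) :: T') (p :: P) (p' :: P')
  | pad {q : List ℕ} {T T' : List (List ℕ)} (hq : ∀ x ∈ q, k < x) (h : SameOuter k T T' [] []) :
      SameOuter k (q :: T) (q :: T') [] []

theorem rowInsert_append_of_le {p : List ℕ} {x : ℕ} (h : ∀ y ∈ p, y ≤ x) (q : List ℕ) :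
    rowInsert (p ++ q) x = (p ++ (rowInsert q x).1, (rowInsert q x).2) := by
  induction p with
  | nil => rfl
  | cons a p ih =>
    rw [List.forall_mem_cons] at h
    rw [List.cons_append, rowInsert_of_le _ h.1, ih h.2, List.cons_append]

theorem rowInsert_append_of_eq_some {p : List ℕ} {x y : ℕ} (h : (rowInsert p x).2 = some y)
    (q : List ℕ) : rowInsert (p ++ q) x = ((rowInsert p x).1 ++ q, some y) := by
  induction p with
  | nil => simp [rowInsert] at h
  | cons a p ih =>
    rcases lt_or_ge x a with hx | hx
    · rw [rowInsert_of_lt p hx, Option.some.injEq] at h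
      rw [List.cons_append, rowInsert_of_lt _ hx, rowInsert_of_lt p hx, h, List.cons_append]
    · rw [rowInsert_of_le p hx] at h ⊢
      rw [List.cons_append, rowInsert_of_le _ hx, ih h, List.cons_append]

theorem rowInsert_append_of_eq_none {p q : List ℕ} {x : ℕ} (h : (rowInsert p x).2 = none)
    (hq : ∀ y ∈ q, x < y) : rowInsert (p ++ q) x = (p ++ [x] ++ q.tail, q.head?) := by
  induction p with
  | nil =>
    rcases q with _ | ⟨b, q⟩
    · rfl
    · exact rowInsert_of_lt q (hq b (by simp))
  | cons a p ih =>
    rcases lt_or_ge x a with hx | hx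
    · simp [rowInsert_of_lt p hx] at h
    · rw [rowInsert_of_le p hx] at h
      rw [List.cons_append, rowInsert_of_le _ hx, ih h]
      simp

theorem tableauInsert_of_eq_none {r r' : List ℕ} {x : ℕ} (h : rowInsert r x = (r', none))
    (rs : List (List ℕ)) : tableauInsert (r :: rs) x = r' :: rs := by
  rw [tableauInsert, h]

theorem tableauInsert_of_eq_some {r r' : List ℕ} {x y : ℕ} (h : rowInsert r x = (r', some y))
    (rs : List (List ℕ)) : tableauInsert (r :: rs) x = r' :: tableauInsert rs y := by
  rw [tableauInsert, h]

theorem rowInsert_lt_of_lt {k x : ℕ} {q : List ℕ} (hq : ∀ y ∈ q, k < y) (hx : k < x) :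
    ∀ y ∈ (rowInsert q x).1, k < y := by
  intro y hy
  rcases mem_rowInsert hy with rfl | hy
  · exact hx
  · exact hq y hy

theorem rowInsert_le_of_le {k x : ℕ} {q : List ℕ} (hq : ∀ y ∈ q, y ≤ k) (hx : x ≤ k) :
    ∀ y ∈ (rowInsert q x).1, y ≤ k := by
  intro y hy
  rcases mem_rowInsert hy with rfl | hy
  · exact hx
  · exact hq y hy

/-- A large letter passes over the small initial part of every row, so it sees the same entries in
both tableaux. -/
theorem SameOuter.insert_large {k : ℕ} {T T' P P' : List (List ℕ)} (h : SameOuter k T T' P P')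
    {x : ℕ} (hx : k < x) : SameOuter k (tableauInsert T x) (tableauInsert T' x) P P' := by
  induction h generalizing x with
  | nil => exact .pad (by simpa using hx) .nil
  | @cons p p' q T T' P P' hl hp hp' hq h ih =>
    have e := rowInsert_append_of_le (fun y hy => (hp y hy).trans hx.le) q
    have e' := rowInsert_append_of_le (fun y hy => (hp' y hy).trans hx.le) q
    have hq' := rowInsert_lt_of_lt hq hx
    rcases ho : (rowInsert q x).2 with _ | y <;> rw [ho] at e e'
    · rw [tableauInsert_of_eq_none e, tableauInsert_of_eq_none e']
      exact .cons hl hp hp' hq' h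
    · rw [tableauInsert_of_eq_some e, tableauInsert_of_eq_some e']
      exact .cons hl hp hp' hq' (ih (hx.trans (lt_of_mem_rowInsert ho).1))
  | @pad q T T' hq h ih =>
    have hq' := rowInsert_lt_of_lt hq hx
    rcases ho : rowInsert q x with ⟨q', _ | y⟩ <;> rw [ho] at hq'
    · rw [tableauInsert_of_eq_none ho, tableauInsert_of_eq_none ho]
      exact .pad hq' h
    · rw [tableauInsert_of_eq_some ho, tableauInsert_of_eq_some ho]
      exact .pad hq' (ih (hx.trans (lt_of_mem_rowInsert (r := q) (by rw [ho])).1))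

/-- While small letters are bumped, the outer parts do not move. By `hs`, both bumping paths of
small letters end in the same row, where they displace the same first large letter, if any; it is
then inserted below in both tableaux. -/
theorem SameOuter.insert_small {k : ℕ} {T T' P P' : List (List ℕ)} (h : SameOuter k T T' P P')
    {x x' : ℕ} (hx : x ≤ k) (hx' : x' ≤ k)
    (hs : (tableauInsert P x).map List.length = (tableauInsert P' x').map List.length) :
    SameOuter k (tableauInsert T x) (tableauInsert T' x') (tableauInsert P x)
      (tableauInsert P' x') := by
  induction h generalizing x x' with
  | nil =>
    exact .cons (p := [x]) (p' := [x']) (q := []) rfl (by simpa using hx) (by simpa using hx')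
      (by simp) .nil
  | @cons p p' q T T' P P' hl hp hp' hq h ih =>
    have l := rowInsert_length p x
    have l' := rowInsert_length p' x'
    have b := rowInsert_le_of_le hp hx
    have b' := rowInsert_le_of_le hp' hx'
    have m := fun y => lt_of_mem_rowInsert (r := p) (x := x) (y := y)
    have m' := fun y => lt_of_mem_rowInsert (r := p') (x := x') (y := y)
    have hs' := congrArg (fun l => l.headD 0) hs
    have e : ∀ (P : List (List ℕ)) (p : List ℕ) (x : ℕ),
        ((tableauInsert (p :: P) x).map List.length).headD 0 = (rowInsert p x).1.length := by
      intro P p x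
      rw [tableauInsert]
      rcases rowInsert p x with ⟨r', _ | y⟩ <;> rfl
    rw [e, e] at hs'
    -- A bump in only one of the two rows would make their lengths differ, against `hs'`.
    rcases o : (rowInsert p x).2 with _ | y <;> rcases o' : (rowInsert p' x').2 with _ | y' <;>
      simp only [o, o', Option.toList, List.length_nil, List.length_singleton] at l l' <;>
      try omega
    · have e := rowInsert_append_of_eq_none o (fun y hy => hx.trans_lt (hq y hy))
      have e' := rowInsert_append_of_eq_none o' (fun y hy => hx'.trans_lt (hq y hy))
      rw [rowInsert_of_eq_none o] at b hs'
      rw [rowInsert_of_eq_none o'] at b' hs'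
      rw [tableauInsert_of_eq_none (Prod.ext (rowInsert_of_eq_none o) o),
        tableauInsert_of_eq_none (Prod.ext (rowInsert_of_eq_none o') o')]
      rcases q with _ | ⟨f, q⟩
      · rw [tableauInsert_of_eq_none e, tableauInsert_of_eq_none e']
        exact .cons hs' b b' (by simp) h
      · rw [tableauInsert_of_eq_some e, tableauInsert_of_eq_some e']
        rw [List.forall_mem_cons] at hq
        exact .cons hs' b b' hq.2 (h.insert_large hq.1)
    · rw [tableauInsert_of_eq_some (rowInsert_append_of_eq_some o q),
        tableauInsert_of_eq_some (rowInsert_append_of_eq_some o' q)]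
      rw [tableauInsert_of_eq_some (Prod.ext rfl o),
        tableauInsert_of_eq_some (Prod.ext rfl o')] at hs ⊢
      simp only [List.map_cons, List.cons.injEq] at hs
      exact .cons hs' b b' hq (ih (hp y (m y o).2) (hp' y' (m' y' o').2) hs.2)
  | @pad q T T' hq h ih =>
    have e := rowInsert_append_of_eq_none (p := []) (x := x) rfl
      (fun y hy => hx.trans_lt (hq y hy))
    have e' := rowInsert_append_of_eq_none (p := []) (x := x') rfl
      (fun y hy => hx'.trans_lt (hq y hy))
    rw [List.nil_append] at e e'
    rcases q with _ | ⟨f, q⟩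
    · rw [tableauInsert_of_eq_none e, tableauInsert_of_eq_none e']
      exact .cons rfl (by simpa using hx) (by simpa using hx') (by simp) h
    · rw [tableauInsert_of_eq_some e, tableauInsert_of_eq_some e']
      rw [List.forall_mem_cons] at hq
      exact .cons rfl (by simpa using hx) (by simpa using hx') hq.2 (h.insert_large hq.1)

theorem sameOuter_insertionRows {k : ℕ} {z : List (ℕ × ℕ)}
    (hz : ∀ p ∈ z, (p.1 ≤ k ∧ p.2 ≤ k) ∨ (p.1 = p.2 ∧ k < p.1))
    (h : SameRecording (z.filter fun p => p.1 ≤ k)) :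
    SameOuter k (insertionRows (z.map Prod.fst)) (insertionRows (z.map Prod.snd))
      (insertionRows ((z.filter fun p => p.1 ≤ k).map Prod.fst))
      (insertionRows ((z.filter fun p => p.1 ≤ k).map Prod.snd)) := by
  induction z using List.reverseRecOn with
  | nil => exact .nil
  | append_singleton z p ih =>
    have hp := hz p (by simp)
    have ih' := ih (fun p hp => hz p (by simp [hp])) (fun v' hv' => h v' (by
      rw [List.filter_append]
      exact hv'.trans (List.prefix_append _ _)))
    rcases hp with ⟨h₁, h₂⟩ | ⟨h₁, h₂⟩
    · have h₃ := h _ (List.prefix_refl _)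
      simp only [List.filter_append, List.map_append, List.filter_singleton, h₁, decide_true,
        cond_true, List.map_cons, List.map_nil, insertionRows_append_singleton] at h₃ ⊢
      exact ih'.insert_small h₁ h₂ h₃
    · simp only [List.filter_append, List.map_append, List.filter_singleton, not_le.2 h₂,
        decide_false, cond_false, List.map_cons, List.map_nil, List.append_nil,
        insertionRows_append_singleton]
      rw [← h₁]
      exact ih'.insert_large h₂

theorem SameOuter.exists_getD {k : ℕ} {T T' P P' : List (List ℕ)} (h : SameOuter k T T' P P')
    (i : ℕ) : ∃ q, T.getD i [] = P.getD i [] ++ q ∧ T'.getD i [] = P'.getD i [] ++ q ∧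
      (P.getD i []).length = (P'.getD i []).length ∧ (∀ x ∈ P.getD i [], x ≤ k) ∧
      ∀ x ∈ q, k < x := by
  induction h generalizing i with
  | nil => exact ⟨[], by simp⟩
  | @cons p p' q T T' P P' hl hp hp' hq h ih =>
    rcases i with _ | i
    · exact ⟨q, by simpa using ⟨hl, hp, hq⟩⟩
    · simpa using ih i
  | @pad q T T' hq h ih =>
    rcases i with _ | i
    · exact ⟨q, by simpa using hq⟩
    · simpa using ih i

/-! ### The right weak order in one-line notation -/

/-- The number of inversions of a word. -/
def inversions : List ℕ → ℕ
  | [] => 0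
  | x :: w => w.countP (· < x) + inversions w

theorem inversions_swap {a b : ℕ} (h : a < b) (A B : List ℕ) :
    inversions (A ++ b :: a :: B) = inversions (A ++ a :: b :: B) + 1 := by
  induction A with
  | nil =>
    simp only [List.nil_append, inversions, List.countP_cons, h, h.not_gt, decide_true,
      decide_false, if_true, Bool.false_eq_true, if_false]
    omega
  | cons c A ih =>
    have : (A ++ b :: a :: B).countP (· < c) = (A ++ a :: b :: B).countP (· < c) :=
      ((List.Perm.swap _ _ _).append_left A).countP_eq _
    simp only [List.cons_append, inversions, ih, this]
    omega

theorem inversions_eq_zero {w : List ℕ} (h : w.Pairwise (· ≤ ·)) : inversions w = 0 := by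
  induction w with
  | nil => rfl
  | cons a w ih =>
    rw [List.pairwise_cons] at h
    rw [inversions, ih h.2, Nat.add_zero, List.countP_eq_zero]
    intro b hb
    simpa using h.1 b hb

theorem sorted_or_exists_descent (w : List ℕ) :
    w.Pairwise (· ≤ ·) ∨ ∃ A a b B, a < b ∧ w = A ++ b :: a :: B := by
  induction w with
  | nil => simp
  | cons a w ih =>
    rcases ih with h | ⟨A, c, d, B, h, rfl⟩
    · rcases w with _ | ⟨b, w⟩
      · simp
      · rcases lt_or_ge b a with hb | hb
        · exact Or.inr ⟨[], b, a, w, hb, rfl⟩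
        · left
          refine List.pairwise_cons.2 ⟨?_, h⟩
          rw [List.forall_mem_cons]
          exact ⟨hb, fun x hx => hb.trans ((List.pairwise_cons.1 h).1 x hx)⟩
    · exact Or.inr ⟨a :: A, c, d, B, h, rfl⟩

theorem oneLine_length {n : ℕ} (u : Equiv.Perm (Fin n)) : (oneLine u).length = n := by
  simp [oneLine]

theorem oneLine_getElem {n : ℕ} (u : Equiv.Perm (Fin n)) (i : ℕ) (h : i < (oneLine u).length) :
    (oneLine u)[i] = (u ⟨i, oneLine_length u ▸ h⟩ : ℕ) + 1 := by
  simp [oneLine]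

theorem oneLine_injective {n : ℕ} : Function.Injective (oneLine (n := n)) := by
  intro u v h
  have := List.ofFn_injective h
  ext i
  simpa using congrFun this i

theorem oneLine_nodup {n : ℕ} (u : Equiv.Perm (Fin n)) : (oneLine u).Nodup := by
  rw [oneLine, List.nodup_ofFn]
  intro i j h
  exact u.injective (Fin.ext (by simpa using h))

theorem mem_oneLine {n : ℕ} (u : Equiv.Perm (Fin n)) {x : ℕ} :
    x ∈ oneLine u ↔ 1 ≤ x ∧ x ≤ n := by
  rw [oneLine, List.mem_ofFn']
  constructor
  · rintro ⟨i, rfl⟩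
    have := (u i).2
    dsimp only
    omega
  · rintro ⟨h₁, h₂⟩
    exact ⟨u.symm ⟨x - 1, by omega⟩, by simp; omega⟩

theorem exists_oneLine_eq {n : ℕ} {L : List ℕ} (hn : L.Nodup)
    (hm : ∀ x, x ∈ L ↔ 1 ≤ x ∧ x ≤ n) : ∃ u : Equiv.Perm (Fin n), oneLine u = L := by
  have hp : L.Perm (oneLine (1 : Equiv.Perm (Fin n))) :=
    (List.perm_ext_iff_of_nodup hn (oneLine_nodup 1)).2 fun x => by rw [hm, mem_oneLine]
  have hl : L.length = n := by rw [hp.length_eq, oneLine_length]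
  have hb : ∀ i : Fin n, 1 ≤ L[i] ∧ L[i] ≤ n := fun i => (hm _).1 (List.getElem_mem _)
  let f : Fin n → Fin n := fun i => ⟨L[i] - 1, by have := hb i; omega⟩
  have hf : Function.Injective f := by
    intro i j h
    have h₁ : L[i] - 1 = L[j] - 1 := congrArg Fin.val h
    have h₂ := hb i
    have h₃ := hb j
    have h₄ : L[(i : ℕ)] = L[(j : ℕ)] := by
      simp only [Fin.getElem_fin] at h₁ h₂ h₃ ⊢
      omega
    exact Fin.ext ((hn.getElem_inj_iff).1 h₄)
  refine ⟨Equiv.ofBijective f (Finite.injective_iff_bijective.1 hf), ?_⟩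
  refine List.ext_getElem (by rw [oneLine_length, hl]) fun i h₁ h₂ => ?_
  rw [oneLine_getElem]
  have := (hb ⟨i, hl ▸ h₂⟩).1
  simp only [Fin.getElem_fin] at this
  simp only [Equiv.ofBijective_apply, f, Fin.getElem_fin]
  omega

theorem oneLine_mul_swap {n : ℕ} (u : Equiv.Perm (Fin n)) {i j : Fin n} (h : (j : ℕ) = i + 1) :
    ∃ A B : List ℕ, A.length = (i : ℕ) ∧
      oneLine u = A ++ ((u i : ℕ) + 1) :: ((u j : ℕ) + 1) :: B ∧
      oneLine (u * Equiv.swap i j) = A ++ ((u j : ℕ) + 1) :: ((u i : ℕ) + 1) :: B := by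
  have split : ∀ v : Equiv.Perm (Fin n), oneLine v =
      (oneLine v).take i ++ ((v i : ℕ) + 1) :: ((v j : ℕ) + 1) :: (oneLine v).drop (i + 2) := by
    intro v
    have hi : (i : ℕ) < (oneLine v).length := by rw [oneLine_length]; exact i.2
    have hj : (i : ℕ) + 1 < (oneLine v).length := by rw [oneLine_length, ← h]; exact j.2
    conv_lhs => rw [← List.take_append_drop i (oneLine v), List.drop_eq_getElem_cons hi,
      List.drop_eq_getElem_cons hj, oneLine_getElem, oneLine_getElem]
    have hj' : j = ⟨i + 1, h ▸ j.2⟩ := Fin.ext h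
    rw [hj']
  have key : ∀ m (h₁ : m < n), m ≠ i → m ≠ j →
      (u * Equiv.swap i j) ⟨m, h₁⟩ = u ⟨m, h₁⟩ := by
    intro m h₁ h₂ h₃
    rw [Equiv.Perm.mul_apply, Equiv.swap_apply_of_ne_of_ne]
    · exact fun h => h₂ (congrArg Fin.val h)
    · exact fun h => h₃ (congrArg Fin.val h)
  refine ⟨(oneLine u).take i, (oneLine u).drop (i + 2), ?_, split u, ?_⟩
  · rw [List.length_take, oneLine_length]
    exact min_eq_left i.2.le
  · rw [split (u * Equiv.swap i j)]
    congr 1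
    · refine List.ext_getElem (by simp [oneLine_length]) fun m h₁ h₂ => ?_
      rw [List.length_take, lt_min_iff] at h₁
      rw [List.getElem_take, List.getElem_take, oneLine_getElem, oneLine_getElem,
        key _ _ (by omega) (by omega)]
    · congr 1
      · simp
      congr 1
      · simp
      refine List.ext_getElem (by simp [oneLine_length]) fun m h₁ h₂ => ?_
      rw [List.getElem_drop, List.getElem_drop, oneLine_getElem, oneLine_getElem,
        key _ _ (by omega) (by omega)]

theorem IsSimple.mul_self {n : ℕ} {s : Equiv.Perm (Fin n)} (h : IsSimple s) : s * s = 1 := by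
  obtain ⟨i, j, -, rfl⟩ := h
  exact Equiv.swap_mul_self i j

theorem IsSimple.oneLine_mul {n : ℕ} {s : Equiv.Perm (Fin n)} (h : IsSimple s)
    (u : Equiv.Perm (Fin n)) : ∃ A a b B, a ≠ b ∧ oneLine u = A ++ a :: b :: B ∧
      oneLine (u * s) = A ++ b :: a :: B := by
  obtain ⟨i, j, hij, rfl⟩ := h
  obtain ⟨A, B, -, h₁, h₂⟩ := oneLine_mul_swap u hij
  refine ⟨A, _, _, B, ?_, h₁, h₂⟩
  intro h
  have : i = j := u.injective (Fin.ext (by omega))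
  subst this
  omega

theorem exists_isSimple_of_oneLine {n : ℕ} {u : Equiv.Perm (Fin n)} {A B : List ℕ} {a b : ℕ}
    (h : oneLine u = A ++ a :: b :: B) :
    ∃ s, IsSimple s ∧ oneLine (u * s) = A ++ b :: a :: B := by
  have hl := congrArg List.length h
  simp only [oneLine_length, List.length_append, List.length_cons] at hl
  obtain ⟨A', B', h₁, h₂, h₃⟩ := oneLine_mul_swap u
    (i := ⟨A.length, by omega⟩) (j := ⟨A.length + 1, by omega⟩) rfl
  refine ⟨_, ⟨_, _, rfl, rfl⟩, h₃.trans ?_⟩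
  obtain ⟨h₄, h₅⟩ := List.append_inj (h₂.symm.trans h) h₁
  simp only [List.cons.injEq] at h₅
  rw [h₄, h₅.1, h₅.2.1, h₅.2.2]

/-- Each simple factor on the right exchanges two neighbouring letters, which changes the number of
inversions by one. -/
theorem inversions_prod_le {n : ℕ} (l : List (Equiv.Perm (Fin n))) (hl : ∀ s ∈ l, IsSimple s) :
    inversions (oneLine l.prod) ≤ l.length := by
  induction l using List.reverseRecOn with
  | nil =>
    have : inversions (oneLine (1 : Equiv.Perm (Fin n))) = 0 := by
      refine inversions_eq_zero ?_
      rw [oneLine, List.pairwise_ofFn]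
      intro i j h
      have h' : (i : ℕ) < j := h
      simp only [Equiv.Perm.one_apply]
      omega
    simp [this]
  | append_singleton l s ih =>
    have h₁ := ih fun s hs => hl s (by simp [hs])
    obtain ⟨A, a, b, B, hab, h₂, h₃⟩ := (hl s (by simp)).oneLine_mul l.prod
    rw [List.prod_append, List.prod_singleton, List.length_append, List.length_singleton, h₃]
    rw [h₂] at h₁
    rcases lt_or_gt_of_ne hab with h | h
    · rw [inversions_swap h]
      omega
    · rw [inversions_swap h] at h₁
      omega

theorem exists_prod_eq {n : ℕ} (u : Equiv.Perm (Fin n)) :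
    ∃ l : List (Equiv.Perm (Fin n)), (∀ s ∈ l, IsSimple s) ∧ l.prod = u ∧
      l.length = inversions (oneLine u) := by
  induction hm : inversions (oneLine u) generalizing u with
  | zero =>
    rcases sorted_or_exists_descent (oneLine u) with h | ⟨A, a, b, B, h, h'⟩
    · have h₁ : (oneLine (1 : Equiv.Perm (Fin n))).Pairwise (· ≤ ·) := by
        rw [oneLine, List.pairwise_ofFn]
        intro i j h
        have h' : (i : ℕ) < j := h
        simp only [Equiv.Perm.one_apply]
        omega
      have h₂ : (oneLine (1 : Equiv.Perm (Fin n))).Perm (oneLine u) :=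
        (List.perm_ext_iff_of_nodup (oneLine_nodup 1) (oneLine_nodup u)).2 fun x => by
          rw [mem_oneLine, mem_oneLine]
      refine ⟨[], by simp, oneLine_injective ?_, rfl⟩
      exact h₂.eq_of_pairwise (fun a b _ _ h h' => le_antisymm h h') h₁ h
    · rw [h', inversions_swap h] at hm
      omega
  | succ m ih =>
    rcases sorted_or_exists_descent (oneLine u) with h | ⟨A, a, b, B, h, h'⟩
    · rw [inversions_eq_zero h] at hm
      omega
    · obtain ⟨s, hs, h₁⟩ := exists_isSimple_of_oneLine h'
      rw [h', inversions_swap h, ← h₁] at hm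
      obtain ⟨l, h₂, h₃, h₄⟩ := ih (u * s) (by omega)
      refine ⟨l ++ [s], ?_, ?_, by simp [h₄]⟩
      · intro t ht
        rw [List.mem_append, List.mem_singleton] at ht
        rcases ht with ht | rfl
        · exact h₂ t ht
        · exact hs
      · rw [List.prod_append, List.prod_singleton, h₃, mul_assoc, hs.mul_self, mul_one]

theorem len_eq_inversions {n : ℕ} (u : Equiv.Perm (Fin n)) : len u = inversions (oneLine u) := by
  obtain ⟨l, h₁, h₂, h₃⟩ := exists_prod_eq u
  refine le_antisymm (Nat.sInf_le ⟨l, h₁, h₂, h₃⟩) (le_csInf ⟨_, l, h₁, h₂, h₃⟩ ?_)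
  rintro m ⟨l, h₁, rfl, rfl⟩
  exact inversions_prod_le l h₁

/-- The length counts inversions, so it increases exactly when the exchanged neighbours form an
ascent. From here on the weak order is handled through words only. -/
theorem permStep_iff {n : ℕ} {u w : Equiv.Perm (Fin n)} : PermStep u w ↔
    ∃ A a b B, a < b ∧ oneLine u = A ++ a :: b :: B ∧ oneLine w = A ++ b :: a :: B := by
  constructor
  · rintro ⟨s, hs, rfl, h⟩
    obtain ⟨A, a, b, B, hab, h₁, h₂⟩ := hs.oneLine_mul u
    rcases lt_or_gt_of_ne hab with h' | h'
    · exact ⟨A, a, b, B, h', h₁, h₂⟩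
    · rw [len_eq_inversions, len_eq_inversions, h₁, h₂, inversions_swap h'] at h
      omega
  · rintro ⟨A, a, b, B, hab, h₁, h₂⟩
    obtain ⟨s, hs, h₃⟩ := exists_isSimple_of_oneLine h₁
    refine ⟨s, hs, oneLine_injective (h₂.trans h₃.symm), ?_⟩
    rw [len_eq_inversions, len_eq_inversions, h₁, h₂, inversions_swap hab]

/-! ### Standard Young tableaux as lists of rows -/

theorem dominates_iff {r s : List ℕ} : Dominates r s ↔
    s.length ≤ r.length ∧ ∀ j < s.length, r.getD j 0 < s.getD j 0 := by
  induction r generalizing s with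
  | nil =>
    rcases s with _ | ⟨b, s⟩
    · simp [Dominates]
    · simp [Dominates]
  | cons a r ih =>
    rcases s with _ | ⟨b, s⟩
    · simp [Dominates]
    · rw [Dominates, ih]
      constructor
      · rintro ⟨h₁, h₂, h₃⟩
        refine ⟨by simpa using h₂, ?_⟩
        rintro (_ | j) hj
        · simpa using h₁
        · simpa using h₃ j (by simpa using hj)
      · rintro ⟨h₂, h₃⟩
        exact ⟨by simpa using h₃ 0 (by simp), by simpa using h₂,
          fun j hj => by simpa using h₃ (j + 1) (by simpa using hj)⟩

theorem isTableau_iff {L : List (List ℕ)} : IsTableau L ↔ ∀ i < L.length,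
    L.getD i [] ≠ [] ∧ (L.getD i []).Pairwise (· ≤ ·) ∧
      Dominates (L.getD i []) (L.getD (i + 1) []) := by
  induction L with
  | nil => simp [IsTableau]
  | cons r rs ih =>
    rw [IsTableau, ih]
    have h₀ : rs.headD [] = rs.getD 0 [] := by cases rs <;> rfl
    constructor
    · rintro ⟨h₁, h₂, h₃, h₄⟩ (_ | i) hi
      · refine ⟨h₁, h₂, ?_⟩
        rw [List.getD_cons_zero, List.getD_cons_succ, ← h₀]
        exact h₃
      · simpa using h₄ i (by simpa using hi)
    · intro h
      have h₁ := h 0 (by simp)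
      simp only [List.getD_cons_zero, zero_add, List.getD_cons_succ, ← h₀] at h₁
      exact ⟨h₁.1, h₁.2.1, h₁.2.2, fun i hi => by simpa using h (i + 1) (by simpa using hi)⟩

theorem IsTableau.dominates_getD {L : List (List ℕ)} (h : IsTableau L) (i : ℕ) :
    Dominates (L.getD i []) (L.getD (i + 1) []) := by
  rcases lt_or_ge i L.length with hi | hi
  · exact (isTableau_iff.1 h i hi).2.2
  · rw [List.getD_eq_default (n := i + 1) _ _ (by omega)]
    exact .nil _

theorem IsTableau.length_getD_anti {L : List (List ℕ)} (h : IsTableau L) :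
    Antitone fun i => (L.getD i []).length :=
  antitone_nat_of_succ_le fun i => (h.dominates_getD i).length_le

theorem mem_readingWord {L : List (List ℕ)} {x : ℕ} :
    x ∈ readingWord L ↔ ∃ i j, j < (L.getD i []).length ∧ (L.getD i []).getD j 0 = x := by
  have aux : ∀ r : List ℕ, x ∈ r ↔ ∃ j, j < r.length ∧ r.getD j 0 = x := by
    intro r
    rw [List.mem_iff_getElem]
    constructor
    · rintro ⟨j, hj, rfl⟩
      exact ⟨j, hj, List.getD_eq_getElem _ _ hj⟩
    · rintro ⟨j, hj, rfl⟩
      exact ⟨j, hj, (List.getD_eq_getElem _ _ hj).symm⟩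
  induction L with
  | nil => simp [readingWord]
  | cons r rs ih =>
    rw [readingWord, List.mem_append]
    refine (or_congr ih (aux r)).trans ?_
    constructor
    · rintro (⟨i, j, h⟩ | ⟨j, h⟩)
      · exact ⟨i + 1, j, by simpa using h⟩
      · exact ⟨0, j, by simpa using h⟩
    · rintro ⟨_ | i, j, h⟩
      · exact Or.inr ⟨j, by simpa using h⟩
      · exact Or.inl ⟨i, j, by simpa using h⟩

theorem eq_of_getD_eq {L : List (List ℕ)} (hn : (readingWord L).Nodup) {i j i' j' : ℕ}
    (hj : j < (L.getD i []).length) (hj' : j' < (L.getD i' []).length)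
    (h : (L.getD i []).getD j 0 = (L.getD i' []).getD j' 0) : i = i' ∧ j = j' := by
  induction L generalizing i i' with
  | nil => simp at hj
  | cons r rs ih =>
    have hn' := List.nodup_append.1 hn
    have aux : ∀ {i j j' : ℕ}, j < r.length → j' < (rs.getD i []).length →
        r.getD j 0 ≠ (rs.getD i []).getD j' 0 := by
      intro i j j' h₁ h₂ h
      refine hn'.2.2 _ (mem_readingWord.2 ⟨i, j', h₂, rfl⟩) (r.getD j 0) ?_ h.symm
      rw [List.getD_eq_getElem _ _ h₁]
      exact List.getElem_mem _
    rcases i with _ | i <;> rcases i' with _ | i' <;>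
      simp only [List.getD_cons_zero, List.getD_cons_succ] at hj hj' h
    · rw [List.getD_eq_getElem _ _ hj, List.getD_eq_getElem _ _ hj'] at h
      exact ⟨rfl, hn'.2.1.getElem_inj_iff.1 h⟩
    · exact (aux hj hj' h).elim
    · exact (aux hj' hj h.symm).elim
    · have := ih hn'.1 hj hj' h
      exact ⟨by omega, this.2⟩

theorem SYT.entry_pos_iff {n : ℕ} (T : SYT n) {i j : ℕ} : 0 < T.entry i j ↔ (i, j) ∈ T.shape := by
  refine ⟨fun h => ?_, fun h => T.one_le h⟩
  by_contra h'
  rw [T.zeros h'] at h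
  exact lt_irrefl _ h

theorem SYT.ext_entry {n : ℕ} {S T : SYT n} (h : ∀ i j, S.entry i j = T.entry i j) : S = T := by
  refine SYT.ext ?_ (funext fun i => funext fun j => h i j)
  ext ⟨i, j⟩
  rw [YoungDiagram.mem_cells, YoungDiagram.mem_cells, ← S.entry_pos_iff, ← T.entry_pos_iff, h]

/-- The list `L` consists of the rows of `T`. -/
def IsRowsOf {n : ℕ} (L : List (List ℕ)) (T : SYT n) : Prop :=
  (∀ i j, (L.getD i []).getD j 0 = T.entry i j) ∧
    ∀ i j, j < (L.getD i []).length ↔ (i, j) ∈ T.shape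

/-- With positive letters the default value `0` marks exactly the missing cells, so agreement of
entries includes agreement of shapes. -/
theorem isRowsOf_of_getD {n : ℕ} {L : List (List ℕ)} {T : SYT n}
    (hL : ∀ x ∈ readingWord L, 0 < x) (h : ∀ i j, (L.getD i []).getD j 0 = T.entry i j) :
    IsRowsOf L T := by
  refine ⟨h, fun i j => ?_⟩
  rw [← T.entry_pos_iff, ← h]
  constructor
  · exact fun hj => hL _ (mem_readingWord.2 ⟨i, j, hj, rfl⟩)
  · intro h'
    by_contra hj
    rw [List.getD_eq_default _ _ (not_lt.1 hj)] at h'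
    exact lt_irrefl _ h'

theorem mem_knuthClass_iff {n : ℕ} {T : SYT n} {w : Equiv.Perm (Fin n)} :
    w ∈ knuthClass T ↔ IsRowsOf (insertionRows (oneLine w)) T := by
  refine ⟨fun h => isRowsOf_of_getD ?_ h, fun h => h.1⟩
  intro x hx
  exact ((mem_oneLine w).1 ((readingWord_insertionRows_perm _).subset hx)).1

theorem exists_isRowsOf {n : ℕ} (T : SYT n) : ∃ L, IsTableau L ∧ IsRowsOf L T := by
  let f : ℕ → List ℕ := fun i => (List.range (T.shape.rowLen i)).map (T.entry i)
  have hf : ∀ i, ((List.range (T.shape.colLen 0)).map f).getD i [] = f i := by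
    intro i
    rcases lt_or_ge i (T.shape.colLen 0) with hi | hi
    · rw [List.getD_eq_getElem _ _ (by simpa using hi)]
      simp
    · rw [List.getD_eq_default _ _ (by simpa using hi)]
      have : T.shape.rowLen i = 0 := by
        by_contra h
        have h₁ := YoungDiagram.mem_iff_lt_rowLen.2 (Nat.pos_of_ne_zero h)
        exact absurd (YoungDiagram.mem_iff_lt_colLen.1 h₁) (not_lt.2 hi)
      simp [f, this]
  have hl : ∀ i, (f i).length = T.shape.rowLen i := by simp [f]
  have hg : ∀ i j, (f i).getD j 0 = T.entry i j := by
    intro i j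
    rcases lt_or_ge j (f i).length with hj | hj
    · rw [List.getD_eq_getElem _ _ hj]
      simp [f]
    · rw [List.getD_eq_default _ _ hj, T.zeros]
      rw [YoungDiagram.mem_iff_lt_rowLen, ← hl]
      exact not_lt.2 hj
  refine ⟨(List.range (T.shape.colLen 0)).map f, isTableau_iff.2 fun i hi => ?_, ?_, ?_⟩
  · rw [hf, hf]
    refine ⟨?_, ?_, dominates_iff.2 ⟨?_, fun j hj => ?_⟩⟩
    · rw [← List.length_pos_iff, hl, ← YoungDiagram.mem_iff_lt_rowLen,
        YoungDiagram.mem_iff_lt_colLen]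
      simpa using hi
    · rw [List.pairwise_map]
      refine (List.pairwise_lt_range (n := T.shape.rowLen i)).imp_of_mem ?_
      intro a b _ hb hab
      exact (T.row_lt hab (YoungDiagram.mem_iff_lt_rowLen.2 (List.mem_range.1 hb))).le
    · rw [hl, hl]
      exact T.shape.rowLen_anti _ _ (Nat.le_succ i)
    · rw [hg, hg]
      rw [hl] at hj
      exact T.col_lt (Nat.lt_succ_self i) (YoungDiagram.mem_iff_lt_rowLen.2 hj)
  · intro i j
    rw [hf, hg]
  · intro i j
    rw [hf, hl, YoungDiagram.mem_iff_lt_rowLen]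

/-- Needed to place every intermediate permutation of a chain in the weak order over some tableau.
-/
theorem exists_mem_knuthClass {n : ℕ} (w : Equiv.Perm (Fin n)) : ∃ T : SYT n, w ∈ knuthClass T := by
  set L := insertionRows (oneLine w) with hL
  have hT : IsTableau L := isTableau_insertionRows _
  have hp : (readingWord L).Perm (oneLine w) := readingWord_insertionRows_perm _
  have hn : (readingWord L).Nodup := hp.nodup_iff.2 (oneLine_nodup w)
  have hsorted := (knuth_readingWord (oneLine_nodup w)).2
  have hm : ∀ x, x ∈ readingWord L ↔ 1 ≤ x ∧ x ≤ n := fun x => by rw [hp.mem_iff, mem_oneLine]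
  let μ : YoungDiagram :=
    { cells := (Finset.range L.length).biUnion fun i =>
        (Finset.range (L.getD i []).length).image fun j => (i, j)
      isLowerSet := by
        rintro ⟨i₂, j₂⟩ ⟨i₁, j₁⟩ ⟨hi, hj⟩ h
        simp only [Finset.coe_biUnion, Finset.coe_range, Set.mem_Iio, Finset.coe_image,
          Set.mem_iUnion, Set.mem_image, Prod.mk.injEq] at h hi hj ⊢
        obtain ⟨_, h₁, _, h₂, rfl, rfl⟩ := h
        exact ⟨i₁, hi.trans_lt h₁, j₁,
          (hj.trans_lt h₂).trans_le (hT.length_getD_anti hi), rfl, rfl⟩ }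
  have hμ : ∀ i j, (i, j) ∈ μ ↔ j < (L.getD i []).length := by
    intro i j
    rw [← YoungDiagram.mem_cells]
    simp only [μ, Finset.mem_biUnion, Finset.mem_range, Finset.mem_image, Prod.mk.injEq]
    constructor
    · rintro ⟨_, -, _, h, rfl, rfl⟩
      exact h
    · intro h
      refine ⟨i, ?_, j, h, rfl, rfl⟩
      by_contra hi
      rw [List.getD_eq_default _ _ (not_lt.1 hi)] at h
      simp at h
  refine ⟨⟨μ, fun i j => (L.getD i []).getD j 0, ?_, ?_, ?_, ?_, ?_, ?_⟩, fun i j => rfl⟩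
  · intro i j₁ j₂ h hc
    have hj := (hμ i j₂).1 hc
    rw [List.getD_eq_getElem _ _ hj, List.getD_eq_getElem _ _ (h.trans hj)]
    have hi : i < L.length := by
      by_contra hi
      rw [List.getD_eq_default _ _ (not_lt.1 hi)] at hj
      simp at hj
    have hr : (L.getD i []).Pairwise (· < ·) := by
      refine hsorted _ ?_
      rw [List.getD_eq_getElem _ _ hi]
      exact List.getElem_mem _
    exact List.pairwise_iff_getElem.1 hr _ _ _ _ h
  · intro i₁ i₂ j h hc
    induction i₂ with
    | zero => omega
    | succ i ih =>
      have h₁ := (dominates_iff.1 (hT.dominates_getD i)).2 j ((hμ _ _).1 hc)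
      rcases (Nat.lt_succ_iff.1 h).eq_or_lt with rfl | h'
      · exact h₁
      · exact (ih h' (μ.up_left_mem (Nat.le_succ i) le_rfl hc)).trans h₁
  · intro i j h
    rw [hμ] at h
    exact List.getD_eq_default _ _ (not_lt.1 h)
  · rintro ⟨i, j⟩ h
    exact (hm _).1 (mem_readingWord.2 ⟨i, j, (hμ i j).1 h, rfl⟩)
  · rintro ⟨i, j⟩ h ⟨i', j'⟩ h' he
    obtain ⟨rfl, rfl⟩ := eq_of_getD_eq hn ((hμ i j).1 h) ((hμ i' j').1 h') he
    rfl
  · intro x hx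
    obtain ⟨i, j, h, rfl⟩ := mem_readingWord.1 ((hm x).2 hx)
    exact ⟨(i, j), (hμ i j).2 h, rfl⟩

/-! ### Columns of a tableau read off the words in its Knuth class -/

theorem eq_of_mem_knuthClass {n : ℕ} {S T : SYT n} {v w : Equiv.Perm (Fin n)}
    (hv : v ∈ knuthClass S) (hw : w ∈ knuthClass T) (h : Knuth (oneLine v) (oneLine w)) :
    S = T :=
  SYT.ext_entry fun i j => by rw [← hv, ← hw, h.insertionRows_eq]

theorem decLe_iff_of_mem {n : ℕ} {T : SYT n} {w : Equiv.Perm (Fin n)} (hw : w ∈ knuthClass T)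
    {i j : ℕ} : DecLe (oneLine w) j (i + 1) ↔ (i, 0) ∈ T.shape ∧ T.entry i 0 ≤ j := by
  rw [mem_knuthClass_iff] at hw
  rw [(knuth_readingWord (oneLine_nodup w)).1.decLe_iff, (isTableau_insertionRows _).decLe_iff,
    ← hw.2, ← hw.1]
  rcases (insertionRows (oneLine w)).getD i [] with _ | ⟨a, r⟩ <;> simp

/-- Increasing subsequences with letters `≤ j` are no longer than the part `≤ j` of the top row, and
the top row is itself such a subsequence of the reading word. Length three detects the third column.
-/
theorem IsTableau.incLe_three_iff {T : List (List ℕ)} {j : ℕ} (hT : IsTableau T)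
    (hr : ∀ r ∈ T, r.Pairwise (· < ·)) : IncLe (readingWord T) j 3 ↔
      2 < (T.getD 0 []).length ∧ (T.getD 0 []).getD 2 0 ≤ j := by
  rw [incLe_iff]
  constructor
  · rintro ⟨s, h₁, h₂, h₃, h₄⟩
    have h := hT.length_le_of_increasing h₁ h₂ h₃
    have hs := hT.sorted_headD
    rw [h₄] at h
    have h₀ : T.headD [] = T.getD 0 [] := by cases T <;> rfl
    rw [h₀] at h hs
    clear h₀
    generalize T.getD 0 [] = r at h hs ⊢
    rcases r with _ | ⟨a, _ | ⟨b, _ | ⟨c, t⟩⟩⟩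
    · simp at h
    · have := h.trans List.countP_le_length
      simp at this
    · have := h.trans List.countP_le_length
      simp at this
    · refine ⟨by simp, ?_⟩
      by_contra hc
      simp only [List.getD_cons_succ, List.getD_cons_zero, not_le] at hc
      simp only [List.pairwise_cons] at hs
      have h0 : (c :: t).countP (· ≤ j) = 0 := by
        rw [List.countP_eq_zero]
        intro x hx
        rw [List.mem_cons] at hx
        rcases hx with rfl | hx
        · simpa using hc
        · simpa using hc.trans_le (hs.2.2.1 x hx)
      rw [List.countP_cons, List.countP_cons, h0] at h
      split_ifs at h <;> omega
  · rcases T with _ | ⟨r, rs⟩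
    · simp
    rw [List.getD_cons_zero]
    rintro ⟨h₁, h₂⟩
    have h := hr r (by simp)
    rcases r with _ | ⟨a, _ | ⟨b, _ | ⟨c, t⟩⟩⟩
    · simp at h₁
    · simp at h₁
    · simp at h₁
    · simp only [List.getD_cons_succ, List.getD_cons_zero] at h₂
      simp only [List.pairwise_cons, List.forall_mem_cons] at h
      refine ⟨[a, b, c], ?_, ?_, ?_, rfl⟩
      · refine .trans ?_ (List.sublist_append_right _ _)
        exact (((List.nil_sublist t).cons_cons c).cons_cons b).cons_cons a
      · simpa using ⟨⟨h.1.1, h.1.2.1⟩, h.2.1.1⟩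
      · simp only [List.forall_mem_cons, List.not_mem_nil, false_imp_iff, implies_true, and_true]
        omega

theorem incLe_iff_of_mem {n : ℕ} {T : SYT n} {w : Equiv.Perm (Fin n)} (hw : w ∈ knuthClass T)
    {j : ℕ} : IncLe (oneLine w) j 3 ↔ (0, 2) ∈ T.shape ∧ T.entry 0 2 ≤ j := by
  rw [mem_knuthClass_iff] at hw
  have h := knuth_readingWord (oneLine_nodup w)
  rw [h.1.incLe_iff, (isTableau_insertionRows _).incLe_three_iff h.2, hw.2, hw.1]

/-- A tableau with at most two columns is determined by its first column. -/
theorem SYT.ext_of_two_columns {k : ℕ} {S T : SYT k} (hS : (0, 2) ∉ S.shape)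
    (hT : (0, 2) ∉ T.shape) (h : ∀ i, S.entry i 0 = T.entry i 0) : S = T := by
  have hcol : ∀ U : SYT k, (0, 2) ∉ U.shape → ∀ i j, (i, j) ∈ U.shape → j = 0 ∨ j = 1 := by
    intro U hU i j hij
    by_contra hj
    exact hU (U.shape.up_left_mem (Nat.zero_le i) (by omega) hij)
  have hcell : ∀ m, ∀ i j i' j', (i, j) ∈ S.shape → (i', j') ∈ T.shape → S.entry i j = m →
      T.entry i' j' = m → i = i' ∧ j = j' := by
    intro m
    induction m using Nat.strong_induction_on with
    | _ m ih =>
    intro i j i' j' hc hd hcm hdm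
    rcases hcol S hS i j hc with rfl | rfl
    · rw [h] at hcm
      have hc' : (i, 0) ∈ T.shape := by
        rw [← T.entry_pos_iff, hcm, ← hdm, T.entry_pos_iff]
        exact hd
      simpa using T.bijOn.injOn hc' hd (hcm.trans hdm.symm)
    rcases hcol T hT i' j' hd with rfl | rfl
    · rw [← h] at hdm
      have hd' : (i', 0) ∈ S.shape := by
        rw [← S.entry_pos_iff, hdm, ← hcm, S.entry_pos_iff]
        exact hc
      simpa using S.bijOn.injOn hc hd' (hcm.trans hdm.symm)
    refine ⟨?_, rfl⟩
    -- If `m` sits in the second column in different rows, the tableau with the lower position has a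
    -- smaller letter at the higher one. By induction that letter is there in the other tableau too,
    -- where the cell contains `m`.
    rcases lt_trichotomy i i' with hlt | rfl | hlt
    · have hd' := T.shape.up_left_mem hlt.le le_rfl hd
      have hm := T.col_lt hlt hd
      obtain ⟨⟨i₂, j₂⟩, hc₂, he⟩ := S.bijOn.surjOn (T.bijOn.mapsTo hd')
      obtain ⟨rfl, rfl⟩ := ih _ (hdm ▸ hm) i₂ j₂ i 1 hc₂ hd' he rfl
      have he' : S.entry i₂ 1 = T.entry i₂ 1 := he
      omega
    · rfl
    · have hc' := S.shape.up_left_mem hlt.le le_rfl hc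
      have hm := S.col_lt hlt hc
      obtain ⟨⟨i₂, j₂⟩, hd₂, he⟩ := T.bijOn.surjOn (S.bijOn.mapsTo hc')
      obtain ⟨rfl, rfl⟩ := ih _ (hcm ▸ hm) i' 1 i₂ j₂ hc' hd₂ rfl he
      have he' : T.entry i' 1 = S.entry i' 1 := he
      omega
  refine SYT.ext_entry fun i j => ?_
  by_cases hc : (i, j) ∈ S.shape
  · obtain ⟨⟨i', j'⟩, hd, he⟩ := T.bijOn.surjOn (S.bijOn.mapsTo hc)
    obtain ⟨rfl, rfl⟩ := hcell _ i j i' j' hc hd rfl he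
    exact he.symm
  · by_cases hd : (i, j) ∈ T.shape
    · obtain ⟨⟨i', j'⟩, hc', he⟩ := S.bijOn.surjOn (T.bijOn.mapsTo hd)
      obtain ⟨rfl, rfl⟩ := hcell _ i' j' i j hc' hd he rfl
      exact absurd hc' hc
    · rw [S.zeros hc, T.zeros hd]

/-! ### The weak order and inner tableaux -/

/-- `S` and `T` have representatives which differ by one step in the right weak order. -/
def CoverStep {n : ℕ} (S T : SYT n) : Prop :=
  ∃ σ ∈ knuthClass S, ∃ τ ∈ knuthClass T, PermStep σ τ

theorem reflTransGen_coverStep_of_permWeakLE {n : ℕ} {S T : SYT n} {σ τ : Equiv.Perm (Fin n)}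
    (hσ : σ ∈ knuthClass S) (hτ : τ ∈ knuthClass T) (h : PermWeakLE σ τ) :
    Relation.ReflTransGen CoverStep S T := by
  induction h generalizing T with
  | refl => rw [eq_of_mem_knuthClass hσ hτ (.refl _)]
  | @tail ρ τ _ h ih =>
    obtain ⟨U, hU⟩ := exists_mem_knuthClass ρ
    exact (ih hU).tail ⟨ρ, hU, τ, hτ, h⟩

theorem reflTransGen_coverStep_of_le {n : ℕ} {S T : SYT n} (h : S ≤ T) :
    Relation.ReflTransGen CoverStep S T := by
  induction h with
  | refl => exact .refl
  | tail _ h ih =>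
    obtain ⟨σ, hσ, τ, hτ, h⟩ := h
    exact ih.trans (reflTransGen_coverStep_of_permWeakLE hσ hτ h)

theorem CoverStep.le {n : ℕ} {S T : SYT n} (h : CoverStep S T) : S ≤ T := by
  obtain ⟨σ, hσ, τ, hτ, h⟩ := h
  exact Relation.ReflTransGen.single ⟨σ, hσ, τ, hτ, .single h⟩

theorem le_trans_syt {n : ℕ} {S T U : SYT n} (h : S ≤ T) (h' : T ≤ U) : S ≤ U :=
  Relation.ReflTransGen.trans h h'

theorem first_column_mono {n : ℕ} {S T : SYT n} (h : Relation.ReflTransGen CoverStep S T)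
    {i j : ℕ} (hS : (i, 0) ∈ S.shape ∧ S.entry i 0 ≤ j) :
    (i, 0) ∈ T.shape ∧ T.entry i 0 ≤ j := by
  induction h with
  | refl => exact hS
  | tail _ h ih =>
    obtain ⟨σ, hσ, τ, hτ, h⟩ := h
    obtain ⟨A, a, b, B, hab, h₁, h₂⟩ := permStep_iff.1 h
    rw [← decLe_iff_of_mem hσ, h₁] at ih
    rw [← decLe_iff_of_mem hτ, h₂]
    exact ih.swap hab

theorem third_column_anti {n : ℕ} {S T : SYT n} (h : Relation.ReflTransGen CoverStep S T)
    {j : ℕ} (hT : (0, 2) ∈ T.shape ∧ T.entry 0 2 ≤ j) :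
    (0, 2) ∈ S.shape ∧ S.entry 0 2 ≤ j := by
  induction h with
  | refl => exact hT
  | tail _ h ih =>
    refine ih ?_
    obtain ⟨σ, hσ, τ, hτ, h⟩ := h
    obtain ⟨A, a, b, B, hab, h₁, h₂⟩ := permStep_iff.1 h
    rw [← incLe_iff_of_mem hτ, h₂] at hT
    rw [← incLe_iff_of_mem hσ, h₁]
    exact hT.swap hab

theorem mem_restrict_shape {n k : ℕ} (hkn : k ≤ n) (T : SYT n) {i j : ℕ} :
    (i, j) ∈ (T.restrict hkn).shape ↔ (i, j) ∈ T.shape ∧ T.entry i j ≤ k :=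
  SYT.mem_restrictShape

/-- The set of tableaux with a given inner tableau with two columns is convex. -/
theorem restrict_eq_of_between {n k : ℕ} (hkn : k ≤ n) {R : SYT k} (hR : (0, 2) ∉ R.shape)
    {S M T : SYT n} (hS : S.restrict hkn = R) (hT : T.restrict hkn = R)
    (h₁ : Relation.ReflTransGen CoverStep S M) (h₂ : Relation.ReflTransGen CoverStep M T) :
    M.restrict hkn = R := by
  have key : ∀ U : SYT n, ∀ i j, j ≤ k → ((i, 0) ∈ U.shape ∧ U.entry i 0 ≤ j ↔
      (i, 0) ∈ (U.restrict hkn).shape ∧ (U.restrict hkn).entry i 0 ≤ j) := by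
    intro U i j hj
    rw [mem_restrict_shape]
    simp only [SYT.restrict]
    constructor
    · rintro ⟨h₁, h₂⟩
      refine ⟨⟨h₁, h₂.trans hj⟩, ?_⟩
      rwa [if_pos (h₂.trans hj)]
    · rintro ⟨⟨h₁, h₂⟩, h₃⟩
      rw [if_pos h₂] at h₃
      exact ⟨h₁, h₃⟩
  have hcol : ∀ i j, j ≤ k → ((i, 0) ∈ (M.restrict hkn).shape ∧ (M.restrict hkn).entry i 0 ≤ j ↔
      (i, 0) ∈ R.shape ∧ R.entry i 0 ≤ j) := by
    intro i j hj
    have hS' := key S i j hj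
    have hT' := key T i j hj
    rw [hS] at hS'
    rw [hT] at hT'
    rw [← key M i j hj]
    exact ⟨fun h => hT'.1 (first_column_mono h₂ h), fun h => first_column_mono h₁ (hS'.2 h)⟩
  -- The first column of `M`, up to letters `≤ k`, is squeezed between those of `S` and `T`, which
  -- agree; a third column in its inner tableau would force one in that of `S`.
  refine SYT.ext_of_two_columns ?_ hR fun i => ?_
  · intro h
    rw [mem_restrict_shape] at h
    refine hR ?_
    rw [← hS, mem_restrict_shape]
    exact third_column_anti h₁ h
  · by_cases hM : (i, 0) ∈ (M.restrict hkn).shape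
    · have hle := (M.restrict hkn).le_size hM
      have h₃ := (hcol i _ hle).1 ⟨hM, le_rfl⟩
      have h₄ := (hcol i _ (R.le_size h₃.1)).2 ⟨h₃.1, le_rfl⟩
      exact le_antisymm h₄.2 h₃.2
    · have hRi : (i, 0) ∉ R.shape := fun h => hM ((hcol i _ (R.le_size h)).2 ⟨h, le_rfl⟩).1
      rw [(M.restrict hkn).zeros hM, R.zeros hRi]

/-! ### Translating a single step -/

/-- Spreads `v` over the positions of the small letters of `w`, and pairs every large letter with
itself. The second components then form the word with its small letters replaced. -/
theorem exists_zip {k : ℕ} (w : List ℕ) (v : List (ℕ × ℕ))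
    (h : v.map Prod.fst = w.filter (· ≤ k)) :
    ∃ z : List (ℕ × ℕ), z.map Prod.fst = w ∧ z.filter (fun p => p.1 ≤ k) = v ∧
      ∀ p ∈ z, p ∈ v ∨ (p.1 = p.2 ∧ k < p.1) := by
  induction w generalizing v with
  | nil =>
    have : v = [] := by simpa using h
    exact ⟨[], by simp [this]⟩
  | cons x w ih =>
    rcases le_or_gt x k with hx | hx
    · rw [List.filter_cons_of_pos (by simpa using hx)] at h
      rcases v with _ | ⟨p, v⟩
      · simp at h
      · simp only [List.map_cons, List.cons.injEq] at h
        obtain ⟨z, h₁, h₂, h₃⟩ := ih v h.2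
        refine ⟨p :: z, by simp [h.1, h₁], ?_, ?_⟩
        · rw [List.filter_cons_of_pos (by simpa [h.1] using hx), h₂]
        · intro q hq
          rw [List.mem_cons] at hq
          rcases hq with rfl | hq
          · simp
          · exact (h₃ q hq).imp_left (List.mem_cons_of_mem p)
    · rw [List.filter_cons_of_neg (by simpa using hx)] at h
      obtain ⟨z, h₁, h₂, h₃⟩ := ih v h
      refine ⟨(x, x) :: z, by simp [h₁], ?_, ?_⟩
      · rw [List.filter_cons_of_neg (by simpa using hx), h₂]
      · intro q hq
        rw [List.mem_cons] at hq
        rcases hq with rfl | hq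
        · exact Or.inr ⟨rfl, hx⟩
        · exact h₃ q hq

theorem exists_oneLine_eq_of_length {n : ℕ} {L : List ℕ} (hl : L.length = n)
    (hm : ∀ x, 1 ≤ x → x ≤ n → x ∈ L) : ∃ u : Equiv.Perm (Fin n), oneLine u = L := by
  have hsub : (oneLine (1 : Equiv.Perm (Fin n))) ⊆ L := fun x hx => by
    have := (mem_oneLine _).1 hx
    exact hm x this.1 this.2
  have hp := (List.subperm_of_subset (oneLine_nodup 1) hsub).perm_of_length_le
    (by rw [oneLine_length, hl])
  exact exists_oneLine_eq (hp.nodup_iff.1 (oneLine_nodup 1)) fun x => by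
    rw [← hp.mem_iff, mem_oneLine]

theorem map_length_eq {L L' : List (List ℕ)} (hL : IsTableau L) (hL' : IsTableau L')
    (h : ∀ i j, j < (L.getD i []).length ↔ j < (L'.getD i []).length) :
    L.map List.length = L'.map List.length := by
  induction L generalizing L' with
  | nil =>
    rcases L' with _ | ⟨r, rs⟩
    · rfl
    · have := (h 0 0).2 (by simpa using List.length_pos_iff.2 hL'.1)
      simp at this
  | cons r rs ih =>
    rcases L' with _ | ⟨r', rs'⟩
    · have := (h 0 0).1 (by simpa using List.length_pos_iff.2 hL.1)
      simp at this
    · simp only [List.map_cons, List.cons.injEq]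
      refine ⟨?_, ih hL.2.2.2 hL'.2.2.2 fun i j => by simpa using h (i + 1) j⟩
      have h₀ := h 0
      simp only [List.getD_cons_zero] at h₀
      exact le_antisymm (le_of_not_gt fun hlt => lt_irrefl _ ((h₀ _).1 hlt))
        (le_of_not_gt fun hlt => lt_irrefl _ ((h₀ _).2 hlt))

theorem SameOuter.lt_length_iff {n k : ℕ} {hkn : k ≤ n} {R : SYT k} (T : SYTInner hkn R)
    {L L' P P' : List (List ℕ)} (h : SameOuter k L L' P P') (hL : IsRowsOf L T.1) (i j : ℕ) :
    j < (P.getD i []).length ↔ (i, j) ∈ R.shape := by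
  rw [mem_inner_iff T, ← hL.1, ← hL.2]
  obtain ⟨q, h₁, -, -, h₂, h₃⟩ := h.exists_getD i
  rw [h₁]
  constructor
  · intro hj
    refine ⟨by rw [List.length_append]; omega, ?_⟩
    rw [List.getD_append _ _ _ _ hj, List.getD_eq_getElem _ _ hj]
    exact h₂ _ (List.getElem_mem _)
  · rintro ⟨hj, hle⟩
    by_contra hj'
    rw [List.getD_append_right _ _ _ _ (not_lt.1 hj')] at hle
    rw [List.length_append] at hj
    rw [List.getD_eq_getElem _ _ (by omega)] at hle
    exact absurd hle (not_le.2 (h₃ _ (List.getElem_mem _)))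

theorem SameOuter.getD_eq {n k : ℕ} {hkn : k ≤ n} {R R' : SYT k} (hsh : R'.shape = R.shape)
    (T : SYTInner hkn R) {L L' P P' : List (List ℕ)} (h : SameOuter k L L' P P')
    (hL : IsRowsOf L T.1) (hP' : IsRowsOf P' R') (i j : ℕ) :
    (L'.getD i []).getD j 0 = (replaceInner hsh T).entry i j := by
  have hlt := h.lt_length_iff T hL i j
  obtain ⟨q, h₁, h₂, h₃, -, -⟩ := h.exists_getD i
  simp only [replaceInner]
  split_ifs with hR
  · have hj := hlt.2 hR
    rw [h₂, List.getD_append _ _ _ _ (h₃ ▸ hj), hP'.1]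
  · have hj := not_lt.1 fun hj => hR (hlt.1 hj)
    rw [h₂, ← hL.1, h₁, List.getD_append_right _ _ _ _ hj,
      List.getD_append_right _ _ _ _ (h₃ ▸ hj), h₃]

/-- If the larger letter of the exchanged ascent is larger than `k`, then the inner tableau can be
replaced by every other tableau of its shape. -/
theorem replaceInner_le_of_large {n k : ℕ} {hkn : k ≤ n} {R R' : SYT k}
    (hsh : R'.shape = R.shape) (S T : SYTInner hkn R) {σ τ : Equiv.Perm (Fin n)}
    (hσ : σ ∈ knuthClass S.1) (hτ : τ ∈ knuthClass T.1) {A B : List ℕ} {a b : ℕ} (hab : a < b)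
    (hb : k < b) (h₁ : oneLine σ = A ++ a :: b :: B) (h₂ : oneLine τ = A ++ b :: a :: B) :
    replaceInner hsh S ≤ replaceInner hsh T := by
  have hσ' := mem_knuthClass_iff.1 hσ
  obtain ⟨P, hP, hPR⟩ := exists_isRowsOf R'
  set u := (oneLine σ).filter (· ≤ k)
  -- Pairing every letter of `σ` with itself shows that inserting only the small letters produces
  -- the shape of `R`.
  have hshape : (insertionRows u).map List.length = P.map List.length := by
    refine map_length_eq (isTableau_insertionRows _) hP fun i j => ?_
    have hd := sameOuter_insertionRows (k := k) (z := (oneLine σ).map fun x => (x, x)) ?_ ?_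
    · have e : ((((oneLine σ).map fun x => (x, x)).filter fun p => p.1 ≤ k).map Prod.fst) = u := by
        rw [List.filter_map, List.map_map]
        exact List.map_id _
      rw [e] at hd
      simp only [List.map_map] at hd
      have := hd.lt_length_iff S (by
        simpa [Function.comp_def] using hσ') i j
      rw [this, hPR.2, hsh]
    · intro p hp
      obtain ⟨x, -, rfl⟩ := List.mem_map.1 hp
      rcases le_or_gt x k with h | h
      · exact Or.inl ⟨h, h⟩
      · exact Or.inr ⟨rfl, h⟩
    · intro v' hv'
      have : v'.map Prod.fst = v'.map Prod.snd := by
        refine List.map_congr_left fun p hp => ?_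
        have := List.mem_of_mem_filter (hv'.subset hp)
        obtain ⟨x, -, rfl⟩ := List.mem_map.1 this
        rfl
      rw [this]
  obtain ⟨v, hv₁, hv₂, hv₃⟩ := exists_sameRecording u hP hshape
  have hvk : ∀ p ∈ v, p.1 ≤ k ∧ p.2 ≤ k := by
    intro p hp
    constructor
    · have : p.1 ∈ u := hv₁ ▸ List.mem_map_of_mem hp
      simpa using (List.mem_filter.1 this).2
    · have : p.2 ∈ v.map Prod.snd := List.mem_map_of_mem hp
      have := (readingWord_insertionRows_perm _).symm.subset this
      rw [hv₂] at this
      obtain ⟨i, j, hj, he⟩ := mem_readingWord.1 this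
      rw [hPR.1] at he
      exact he ▸ R'.le_size ((hPR.2 i j).1 hj)
  have hvmem : ∀ x, 1 ≤ x → x ≤ k → x ∈ v.map Prod.snd := by
    intro x hx hxk
    refine (readingWord_insertionRows_perm _).subset ?_
    rw [hv₂, mem_readingWord]
    obtain ⟨⟨i, j⟩, hc, he⟩ := R'.bijOn.surjOn (show x ∈ Set.Icc 1 k from ⟨hx, hxk⟩)
    exact ⟨i, j, (hPR.2 i j).2 hc, (hPR.1 i j).trans he⟩
  obtain ⟨z, hz₁, hz₂, hz₃⟩ := exists_zip (oneLine σ) v hv₁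
  -- Stated for any `z'` with small part `v`, because it serves for `σ` and `τ` alike: the swap
  -- involves the large letter `b` and leaves the small subword unchanged.
  have key : ∀ (U : SYTInner hkn R) (ρ : Equiv.Perm (Fin n)) (z' : List (ℕ × ℕ)),
      ρ ∈ knuthClass U.1 → z'.map Prod.fst = oneLine ρ → z'.filter (fun p => p.1 ≤ k) = v →
      z'.Perm z → ∃ ρ' ∈ knuthClass (replaceInner hsh U), oneLine ρ' = z'.map Prod.snd := by
    intro U ρ z' hρ hz₁' hz₂' hp
    have hz₃' : ∀ p ∈ z', p ∈ v ∨ (p.1 = p.2 ∧ k < p.1) := fun p hp' => hz₃ p (hp.subset hp')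
    obtain ⟨ρ', hρ'⟩ := exists_oneLine_eq_of_length (n := n) (L := z'.map Prod.snd) (by
        rw [List.length_map, ← List.length_map (f := Prod.fst), hz₁', oneLine_length]) (by
      intro x hx hxn
      rcases le_or_gt x k with hxk | hxk
      · obtain ⟨p, hp, rfl⟩ := List.mem_map.1 (hvmem x hx hxk)
        rw [← hz₂'] at hp
        exact List.mem_map_of_mem (List.mem_of_mem_filter hp)
      · have : x ∈ z'.map Prod.fst := by rw [hz₁', mem_oneLine]; exact ⟨hx, hxn⟩
        obtain ⟨p, hp, rfl⟩ := List.mem_map.1 this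
        rcases hz₃' p hp with h | h
        · exact absurd (hvk p h).1 (not_le.2 hxk)
        · rw [h.1]
          exact List.mem_map_of_mem hp)
    refine ⟨ρ', fun i j => ?_, hρ'⟩
    have hd := sameOuter_insertionRows (k := k) (z := z')
      (fun p hp => (hz₃' p hp).imp_left (hvk p)) (hz₂' ▸ hv₃)
    rw [hz₂', hz₁', hv₂] at hd
    rw [hρ']
    exact hd.getD_eq hsh U (mem_knuthClass_iff.1 hρ) hPR i j
  rw [h₁] at hz₁
  obtain ⟨zA, z', rfl, rfl, hz'⟩ := List.map_eq_append_iff.1 hz₁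
  obtain ⟨pa, z'', rfl, rfl, hz''⟩ := List.map_eq_cons_iff.1 hz'
  obtain ⟨pb, zB, rfl, rfl, rfl⟩ := List.map_eq_cons_iff.1 hz''
  have hpb : pb.1 = pb.2 := by
    rcases hz₃ pb (by simp) with h | h
    · exact absurd (hvk pb h).1 (not_le.2 hb)
    · exact h.1
  -- The pair remains an ascent: `b` is unchanged, and `a` is either unchanged or replaced by a
  -- letter `≤ k < b`.
  have hpa : pa.2 < pb.2 := by
    rcases hz₃ pa (by simp) with h | h
    · exact ((hvk pa h).2.trans_lt hb).trans_eq hpb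
    · rw [← h.1, ← hpb]
      exact hab
  obtain ⟨σ', hσ'', e₁⟩ := key S σ _ hσ (by rw [h₁]; simp) hz₂ (.refl _)
  obtain ⟨τ', hτ'', e₂⟩ := key T τ (zA ++ pb :: pa :: zB) hτ (by rw [h₂]; simp) (by
      rw [← hz₂]
      simp [List.filter_cons, hb]) ((List.Perm.swap _ _ _).append_left _)
  refine CoverStep.le ⟨σ', hσ'', τ', hτ'', permStep_iff.2
    ⟨zA.map Prod.snd, pa.2, pb.2, zB.map Prod.snd, hpa, ?_, ?_⟩⟩
  · simpa using e₁
  · simpa using e₂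

theorem CoverStep.replaceInner_le {n k : ℕ} {hkn : k ≤ n} {R R' : SYT k}
    (hsh : R'.shape = R.shape) (hR : (0, 2) ∉ R.shape) (S T : SYTInner hkn R)
    (h : CoverStep S.1 T.1) : replaceInner hsh S ≤ replaceInner hsh T := by
  obtain ⟨σ, hσ, τ, hτ, h⟩ := h
  obtain ⟨A, a, b, B, hab, h₁, h₂⟩ := permStep_iff.1 h
  have hent : ∀ U : SYTInner hkn R, ∀ i j, j ≤ k →
      ((i, 0) ∈ U.1.shape ∧ U.1.entry i 0 ≤ j ↔ (i, 0) ∈ R.shape ∧ R.entry i 0 ≤ j) := by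
    rintro ⟨U, rfl⟩ i j hj
    rw [mem_restrict_shape]
    simp only [SYT.restrict]
    constructor
    · rintro ⟨h₁, h₂⟩
      exact ⟨⟨h₁, h₂.trans hj⟩, by rwa [if_pos (h₂.trans hj)]⟩
    · rintro ⟨⟨h₁, h₂⟩, h₃⟩
      rw [if_pos h₂] at h₃
      exact ⟨h₁, h₃⟩
  -- For `j ≤ k` both sides only depend on the first column of the common inner tableau `R`. The
  -- case `d = 0` is trivial and is not covered by the row description.
  have hdec : ∀ j ≤ k, ∀ d, DecLe (A ++ b :: a :: B) j d → DecLe (A ++ a :: b :: B) j d := by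
    rintro j hj (_ | d) hd
    · exact ⟨[], by simp⟩
    · rw [← h₂, decLe_iff_of_mem hτ, hent T d j hj, ← hent S d j hj] at hd
      rwa [← h₁, decLe_iff_of_mem hσ]
  have hinc : ¬ IncLe (A ++ a :: b :: B) k 3 := by
    rw [← h₁, incLe_iff_of_mem hσ, ← mem_inner_iff S]
    exact hR
  rcases exists_swap_large hab (h₁ ▸ oneLine_nodup σ) hdec hinc with
    h | ⟨A', a', b', B', hab', hb', k₁, k₂⟩
  · rw [← h₁, ← h₂] at h
    rw [Subtype.ext (eq_of_mem_knuthClass hσ hτ h)]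
    exact Relation.ReflTransGen.refl
  · rw [← h₁] at k₁
    rw [← h₂] at k₂
    have ex : ∀ {ρ : Equiv.Perm (Fin n)} {w : List ℕ}, Knuth (oneLine ρ) w →
        ∃ ρ' : Equiv.Perm (Fin n), oneLine ρ' = w := fun h =>
      exists_oneLine_eq (h.perm.nodup_iff.1 (oneLine_nodup _))
        fun x => by rw [← h.perm.mem_iff, mem_oneLine]
    obtain ⟨σ', e₁⟩ := ex k₁
    obtain ⟨τ', e₂⟩ := ex k₂
    refine replaceInner_le_of_large hsh S T (σ := σ') (τ := τ') ?_ ?_ hab' hb' e₁ e₂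
    · intro i j
      rw [e₁, ← k₁.insertionRows_eq]
      exact hσ i j
    · intro i j
      rw [e₂, ← k₂.insertionRows_eq]
      exact hτ i j

/-! ### Monotonicity of the translation, and covers -/

/-- Convexity keeps the intermediate tableaux of a chain inside `SYTInner hkn R`, so each step can
be translated separately. -/
theorem replaceInner_mono {n k : ℕ} {hkn : k ≤ n} {R R' : SYT k}
    (hsh : R'.shape = R.shape) (hR : (0, 2) ∉ R.shape) (S T : SYTInner hkn R)
    (h : S.1 ≤ T.1) : replaceInner hsh S ≤ replaceInner hsh T := by
  obtain ⟨T, hT⟩ := T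
  have h' := reflTransGen_coverStep_of_le h
  clear h
  dsimp only at h'
  induction h' with
  | refl => exact Relation.ReflTransGen.refl
  | @tail M T h₁ h₂ ih =>
    have hM := restrict_eq_of_between hkn hR S.2 hT h₁ (.single h₂)
    exact le_trans_syt (ih hM) (h₂.replaceInner_le hsh hR ⟨M, hM⟩ ⟨T, hT⟩)

theorem innerTranslation_innerTranslation {n k : ℕ} (hkn : k ≤ n) {R R' : SYT k}
    (hsh : R'.shape = R.shape) (T : SYTInner hkn R) :
    innerTranslation hkn hsh.symm (innerTranslation hkn hsh T) = T := by
  refine Subtype.ext (SYT.ext_entry fun i j => ?_)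
  simp only [innerTranslation, replaceInner, hsh]
  split_ifs with h
  · obtain ⟨T, rfl⟩ := T
    rw [mem_restrict_shape] at h
    exact if_pos h.2
  · rfl

/-- Since `<` means `≤` and `≠`, strictness follows from injectivity, and antisymmetry of the weak
order plays no role. -/
theorem innerTranslation_lt {n k : ℕ} (hkn : k ≤ n) {R R' : SYT k} (hsh : R'.shape = R.shape)
    (hR : (0, 2) ∉ R.shape) {S T : SYTInner hkn R} (h : S < T) :
    innerTranslation hkn hsh S < innerTranslation hkn hsh T := by
  refine ⟨replaceInner_mono hsh hR S T h.1, fun he => h.2 ?_⟩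
  have := congrArg (innerTranslation hkn hsh.symm) (Subtype.ext he)
  rw [innerTranslation_innerTranslation, innerTranslation_innerTranslation] at this
  rw [this]

end TableauWeakOrder

theorem mainTheorem2 {n k : ℕ} (hkn : k < n)
    (R R' : TableauWeakOrder.SYT k)
    (hcols : R.shape.rowLen 0 = 2)
    (hshape : R'.shape = R.shape)
    (S T : TableauWeakOrder.SYTInner hkn.le R)
    (hST : S ⋖ T) :
    TableauWeakOrder.innerTranslation hkn.le hshape S ⋖
      TableauWeakOrder.innerTranslation hkn.le hshape T := by
  have hR : (0, 2) ∉ R.shape := by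
    rw [YoungDiagram.mem_iff_lt_rowLen, hcols]
    exact lt_irrefl 2
  refine ⟨TableauWeakOrder.innerTranslation_lt hkn.le hshape hR hST.1, fun U h₁ h₂ => ?_⟩
  -- A tableau `U` strictly between the images is pulled back by the inverse translation, which is
  -- strictly monotone because `R'` has the shape of `R`.
  have h₃ := TableauWeakOrder.innerTranslation_lt hkn.le hshape.symm (hshape ▸ hR) h₁
  have h₄ := TableauWeakOrder.innerTranslation_lt hkn.le hshape.symm (hshape ▸ hR) h₂
  rw [TableauWeakOrder.innerTranslation_innerTranslation] at h₃ h₄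
  exact hST.2 h₃ h₄
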